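/- Let $(M,g)$ be a smooth pseudo-Riemannian manifold of dimension $n\ge 2$ (of arbitrary signature), with Levi-Civita connection $\nabla$, curvature tensor $R(X,Y)Z=\nabla_X\nabla_YZ-\nabla_Y\nabla_XZ-\nabla_{[X,Y]}Z$, Laplace–Beltrami operator $\Delta_M$ (the trace of the Hessian $\nabla d$, so $\Delta_{\mathbb R^n}=\sum_i\partial^2/\partial x_i^2$ for the standard Riemannian metric) and scalar curvature $$K_M(x)=\sum_{i,j=1}^n\varepsilon_i\varepsilon_j\,g\big(R(X_i,X_j)X_j,X_i\big),$$ where $X_1,\dots,X_n$ is a basis of $T_xM$ with $g(X_i,X_j)=\varepsilon_i\delta_{ij}$, $\varepsilon_i=\pm1$ (so $K_{S^n}=n(n-1)$ for the unit sphere). The Yamabe operator is $\widetilde\Delta_M=\Delta_M-\frac{n-2}{4(n-1)}K_M$, acting on the space $C^\infty(M)$ of smooth complex-valued functions. Let a group $G$ act on $M$ by smooth maps $L_h\colon M\to M$ $(h\in G)$, conformally: for every $h\in G$ there is a positive function $\Omega(h,\cdot)$ on $M$ with $L_h^*g=\Omega(h,\cdot)^2g$. For $\lambda\in\mathbb C$,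 $h\in G$, $f\in C^\infty(M)$ and $x\in M$ put $$(\varpi_\lambda(h^{-1})f)(x)=\Omega(h,x)^\lambda f(L_hx).$$ Then, for every $\lambda\in\mathbb C$, $\varpi_\lambda$ is a representation of $G$ on $C^\infty(M)$, and: 1. $\widetilde\Delta_M$ is a linear map $C^\infty(M)\to C^\infty(M)$ which intertwines $\varpi_{\frac{n-2}2}$ and $\varpi_{\frac{n+2}2}$, that is, $\widetilde\Delta_M\,\varpi_{\frac{n-2}2}(h)=\varpi_{\frac{n+2}2}(h)\,\widetilde\Delta_M$ for all $h\in G$. 2. The kernel $\operatorname{Ker}\widetilde\Delta_M\subseteq C^\infty(M)$ is a subrepresentation of $\varpi_{\frac{n-2}2}$. -/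

import Mathlib

open scoped Manifold ContDiff Bundle

noncomputable section

/-! ### Pseudo-Riemannian metrics and conformal maps -/

/-- A smooth pseudo-Riemannian metric on a manifold `M` without boundary, modelled on the
finite-dimensional real vector space `E`: a smooth field of nondegenerate symmetric bilinear forms
on the tangent spaces. -/
structure PseudoRiemannianMetric (E : Type*) [NormedAddCommGroup E] [NormedSpace ℝ E]
    (M : Type*) [TopologicalSpace M] [ChartedSpace E M] [IsManifold 𝓘(ℝ, E) ∞ M] where
  val (x : M) : TangentSpace 𝓘(ℝ, E) x →L[ℝ] TangentSpace 𝓘(ℝ, E) x →L[ℝ] ℝ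
  symm (x : M) (u v : TangentSpace 𝓘(ℝ, E) x) : val x u v = val x v u
  nondegenerate (x : M) (u : TangentSpace 𝓘(ℝ, E) x) : (∀ v, val x u v = 0) → u = 0
  contMDiff : ContMDiff 𝓘(ℝ, E) (𝓘(ℝ, E).prod 𝓘(ℝ, E →L[ℝ] E →L[ℝ] ℝ)) ∞
    (fun x : M ↦ Bundle.TotalSpace.mk' (E →L[ℝ] E →L[ℝ] ℝ)
      (E := fun x : M ↦ TangentSpace 𝓘(ℝ, E) x →L[ℝ] TangentSpace 𝓘(ℝ, E) x →L[ℝ] ℝ) x (val x))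

/-- `Ω` is a positive function with `Φ^* g = Ω ^ 2 g`. -/
def IsConformalFactor {E : Type*} [NormedAddCommGroup E] [NormedSpace ℝ E]
    {M : Type*} [TopologicalSpace M] [ChartedSpace E M] [IsManifold 𝓘(ℝ, E) ∞ M]
    (g : PseudoRiemannianMetric E M) (Φ : M → M) (Ω : M → ℝ) : Prop :=
  (∀ x, 0 < Ω x) ∧
    ∀ (x : M) (u v : TangentSpace 𝓘(ℝ, E) x),
      g.val (Φ x) (mfderiv 𝓘(ℝ, E) 𝓘(ℝ, E) Φ x u) (mfderiv 𝓘(ℝ, E) 𝓘(ℝ, E) Φ x v) =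
        Ω x ^ 2 * g.val x u v

/-! ### Levi-Civita connection, curvature and Laplacian of a metric on an open subset of `E`

In this section `G : E → E →L[ℝ] E →L[ℝ] ℝ` is a pseudo-Riemannian metric near the point `y : E`
under consideration. -/

namespace LocalMetric

variable {E : Type*} [NormedAddCommGroup E] [NormedSpace ℝ E]

/-- The isomorphism from covectors to vectors: `G y (sharp G y α) = α`. -/
def sharp (G : E → E →L[ℝ] E →L[ℝ] ℝ) (y : E) : (E →L[ℝ] ℝ) →L[ℝ] E :=
  ContinuousLinearMap.inverse (G y)

/-- The covector `w ↦ (∂_u G(v, w) + ∂_v G(u, w) - ∂_w G(u, v)) / 2` of the Koszul formula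
for the constant vector fields `u`, `v`, `w`. -/
def koszul (G : E → E →L[ℝ] E →L[ℝ] ℝ) (y : E) (u v : E) : E →L[ℝ] ℝ :=
  (1 / 2 : ℝ) • (fderiv ℝ G y u v + fderiv ℝ G y v u - ((fderiv ℝ G y).flip u).flip v)

/-- The Christoffel symbols: `christoffel G y u v` is `∇_u v` at `y` for the constant vector
fields `u` and `v`. -/
def christoffel (G : E → E →L[ℝ] E →L[ℝ] ℝ) (y : E) (u v : E) : E :=
  sharp G y (koszul G y u v)

/-- The Levi-Civita covariant derivative `∇_X Z` of vector fields. -/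
def cov (G : E → E →L[ℝ] E →L[ℝ] ℝ) (X Z : E → E) (y : E) : E :=
  fderiv ℝ Z y (X y) + christoffel G y (X y) (Z y)

/-- The curvature `R(X, Y) Z = ∇_X ∇_Y Z - ∇_Y ∇_X Z - ∇_[X, Y] Z`. -/
def curvature (G : E → E →L[ℝ] E →L[ℝ] ℝ) (X Y Z : E → E) (y : E) : E :=
  cov G X (cov G Y Z) y - cov G Y (cov G X Z) y - cov G (VectorField.lieBracket ℝ X Y) Z y

variable [FiniteDimensional ℝ E]

/-- The `i`-th coordinate covector of the basis `Module.finBasis ℝ E` of `E`. -/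
def coord (i : Fin (Module.finrank ℝ E)) : E →L[ℝ] ℝ :=
  LinearMap.toContinuousLinearMap ((Module.finBasis ℝ E).coord i)

/-- The scalar curvature `∑ i, ∑ j, G(R(b_i, b_j) b^j, b^i)`, where `b` is a basis of `E` and
`b^i = sharp (coord i)` is the dual basis with respect to `G y`. It does not depend on `b`; for an
orthonormal basis, `G(b_i, b_j) = ε_i δ_ij` with `ε_i = ± 1`, one has `b^i = ε_i b_i` and it is
`∑ i, ∑ j, ε_i ε_j G(R(b_i, b_j) b_j, b_i)`, which is `n (n - 1)` for the unit sphere. -/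
def scalarCurvature (G : E → E →L[ℝ] E →L[ℝ] ℝ) (y : E) : ℝ :=
  ∑ i, ∑ j, G y
    (curvature G (fun _ ↦ Module.finBasis ℝ E i) (fun _ ↦ Module.finBasis ℝ E j)
      (fun _ ↦ sharp G y (coord j)) y)
    (sharp G y (coord i))

/-- The Hessian `(∇ df)(u, v) = u (v f) - (∇_u v) f` (for constant `u`, `v`) of a complex-valued
function. -/
def hessian (G : E → E →L[ℝ] E →L[ℝ] ℝ) (f : E → ℂ) (y : E) (u v : E) : ℂ :=
  fderiv ℝ (fderiv ℝ f) y u v - fderiv ℝ f y (christoffel G y u v)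

/-- The Laplace-Beltrami operator: the trace `∑ i, (∇ df)(b_i, b^i)` of the Hessian with respect to
`G`. It does not depend on the basis `b`. -/
def laplacian (G : E → E →L[ℝ] E →L[ℝ] ℝ) (f : E → ℂ) (y : E) : ℂ :=
  ∑ i, hessian G f y (Module.finBasis ℝ E i) (sharp G y (coord i))

end LocalMetric

/-! ### The Yamabe operator of a pseudo-Riemannian manifold -/

namespace PseudoRiemannianMetric

variable {E : Type*} [NormedAddCommGroup E] [NormedSpace ℝ E]
  {M : Type*} [TopologicalSpace M] [ChartedSpace E M] [IsManifold 𝓘(ℝ, E) ∞ M]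

/-- The metric `g` read in a chart `e`, that is, the pullback of `g` under `e.symm`. -/
def inChart (g : PseudoRiemannianMetric E M) (e : OpenPartialHomeomorph M E) (y : E) :
    E →L[ℝ] E →L[ℝ] ℝ :=
  ContinuousLinearMap.bilinearComp (E := E) (F := E) (E' := E) (F' := E) (g.val (e.symm y))
    (mfderiv 𝓘(ℝ, E) 𝓘(ℝ, E) e.symm y) (mfderiv 𝓘(ℝ, E) 𝓘(ℝ, E) e.symm y)

variable [FiniteDimensional ℝ E]

/-- The scalar curvature `K_M`, computed at each point `x` in the preferred chart at `x`. -/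
def scalarCurvature (g : PseudoRiemannianMetric E M) (x : M) : ℝ :=
  LocalMetric.scalarCurvature (g.inChart (chartAt E x)) (chartAt E x x)

/-- The Laplace-Beltrami operator `Δ_M`, computed at each point `x` in the preferred chart
at `x`. -/
def laplacian (g : PseudoRiemannianMetric E M) (f : M → ℂ) (x : M) : ℂ :=
  LocalMetric.laplacian (g.inChart (chartAt E x)) (f ∘ (chartAt E x).symm) (chartAt E x x)

/-- The Yamabe operator `Δ_M - (n - 2) / (4 (n - 1)) K_M`, `n = dim M`. -/
def yamabe (g : PseudoRiemannianMetric E M) (f : M → ℂ) (x : M) : ℂ :=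
  g.laplacian f x -
    ((Module.finrank ℝ E : ℂ) - 2) / (4 * ((Module.finrank ℝ E : ℂ) - 1)) *
      (g.scalarCurvature x : ℂ) * f x

end PseudoRiemannianMetric

/-- The complex vector space `C^∞(M)` of smooth complex-valued functions on `M`. -/
def SmoothFunctions (E : Type*) [NormedAddCommGroup E] [NormedSpace ℝ E]
    (M : Type*) [TopologicalSpace M] [ChartedSpace E M] : Submodule ℂ (M → ℂ) where
  carrier := {f | ContMDiff 𝓘(ℝ, E) 𝓘(ℝ, ℂ) ∞ f}
  add_mem' hf hg := ContMDiff.add hf hg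
  zero_mem' := contMDiff_const
  smul_mem' c f hf := by
    have h : ContMDiff 𝓘(ℝ, E) 𝓘(ℝ, ℂ) ∞ (fun x ↦ c * f x) :=
      ContMDiff.comp (I' := 𝓘(ℝ, ℂ)) (g := fun z : ℂ ↦ c * z)
        (ContDiff.contMDiff (contDiff_const.mul contDiff_id)) hf
    exact h

end

/-! Everything reduces to two properties of the Yamabe operator: it commutes with isometries, and it
is covariant under a conformal change `e ^ (2 σ) G` of the metric. Since `Φ^* g = Ω ^ 2 g` says that
`Φ` is an isometry from `(M, Ω ^ 2 g)` to `(M, g)`, both together, with `σ = log Ω`, give the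
intertwining relation.

For isometries (`map_christoffel`, `map_curvatureTensor`, `hessianBilin_comp`), the Levi-Civita
connection is determined by being torsion-free and metric, so it is preserved, and traces do not
depend on the basis (`sum_bilin_equiv`).

For conformal changes, write `n` for the dimension, `H` for the trace of the Hessian of `σ` and `Q`
for the squared length of its gradient. The new scalar curvature is `e ^ (-2 σ) (K - 2 (n - 1) H -
(n - 1) (n - 2) Q)`, the new Laplacian is `e ^ (-2 σ) (Δ f + (n - 2) df(grad σ))`, and `Δ (e ^ (a σ)
f) = e ^ (a σ) (Δ f + 2 a df(grad σ) + (a H + a ^ 2 Q) f)`. With `a = (n - 2) / 2` the gradient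
terms agree, and the coefficient `(n - 2) / (4 (n - 1))` of `K` is the one that also matches `H` and
`Q` (`yamabe_exp_mul`).

All this is done on open subsets of `E` and carried to `M` by charts. Conformal factors in positive
dimension are unique, which makes `Ω` a cocycle and `ϖ` a representation; their smoothness is proved
rather than assumed. -/

set_option maxSynthPendingDepth 3
set_option linter.unusedSectionVars false

/-! ### Levi-Civita connection, curvature and Hessian on an open subset of `E`. -/

namespace LocalMetric

variable {E : Type*} [NormedAddCommGroup E] [NormedSpace ℝ E]

/-- `G` is a smooth pseudo-Riemannian metric on the open subset `U` of `E`. -/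
structure IsMetricOn (G : E → E →L[ℝ] E →L[ℝ] ℝ) (U : Set E) : Prop where
  isOpen : IsOpen U
  contDiffOn : ContDiffOn ℝ ∞ G U
  symm : ∀ y ∈ U, ∀ u v, G y u v = G y v u
  nondegenerate : ∀ y ∈ U, ∀ u, (∀ v, G y u v = 0) → u = 0

/-- The Koszul covectors as a bilinear map. -/
noncomputable def koszulBilin (G : E → E →L[ℝ] E →L[ℝ] ℝ) (y : E) :
    E →L[ℝ] E →L[ℝ] E →L[ℝ] ℝ :=
  (1 / 2 : ℝ) • (fderiv ℝ G y + (fderiv ℝ G y).flip -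
    ((ContinuousLinearMap.flipₗᵢ ℝ E E ℝ).toContinuousLinearEquiv :
      (E →L[ℝ] E →L[ℝ] ℝ) →L[ℝ] (E →L[ℝ] E →L[ℝ] ℝ)).comp (fderiv ℝ G y).flip)

/-- The Christoffel symbols as a bilinear map. -/
noncomputable def christoffelBilin (G : E → E →L[ℝ] E →L[ℝ] ℝ) (y : E) : E →L[ℝ] E →L[ℝ] E :=
  (ContinuousLinearMap.compL ℝ E (E →L[ℝ] ℝ) E (sharp G y)).comp (koszulBilin G y)

lemma christoffelBilin_apply (G : E → E →L[ℝ] E →L[ℝ] ℝ) (y u v : E) :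
    christoffelBilin G y u v = christoffel G y u v := rfl

lemma koszul_apply (G : E → E →L[ℝ] E →L[ℝ] ℝ) (y u v w : E) :
    koszul G y u v w =
      (fderiv ℝ G y u v w + fderiv ℝ G y v u w - fderiv ℝ G y w u v) / 2 := by
  simp [koszul]; ring

/-- The curvature tensor expressed by the Christoffel symbols and their derivatives. -/
noncomputable def curvatureTensor (G : E → E →L[ℝ] E →L[ℝ] ℝ) (y u v w : E) : E :=
  fderiv ℝ (christoffelBilin G) y u v w - fderiv ℝ (christoffelBilin G) y v u w
    + christoffelBilin G y u (christoffelBilin G y v w)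
    - christoffelBilin G y v (christoffelBilin G y u w)

/-- The Hessian as a bilinear map. -/
noncomputable def hessianBilin {F : Type*} [NormedAddCommGroup F] [NormedSpace ℝ F]
    (G : E → E →L[ℝ] E →L[ℝ] ℝ) (f : E → F) (y : E) :
    E →L[ℝ] E →L[ℝ] F :=
  fderiv ℝ (fderiv ℝ f) y -
    (ContinuousLinearMap.compL ℝ E E F (fderiv ℝ f y)).comp (christoffelBilin G y)

lemma hessianBilin_apply {F : Type*} [NormedAddCommGroup F] [NormedSpace ℝ F]
    (G : E → E →L[ℝ] E →L[ℝ] ℝ) (f : E → F) (y u v : E) :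
    hessianBilin G f y u v =
      fderiv ℝ (fderiv ℝ f) y u v - fderiv ℝ f y (christoffelBilin G y u v) := rfl

lemma hessian_eq (G : E → E →L[ℝ] E →L[ℝ] ℝ) (f : E → ℂ) (y u v : E) :
    hessian G f y u v = hessianBilin G f y u v := rfl

lemma fderiv_apply_apply {F : Type*} [NormedAddCommGroup F] [NormedSpace ℝ F]
    {A : E → E →L[ℝ] E →L[ℝ] F} {y : E} (hA : DifferentiableAt ℝ A y) (u v w : E) :
    fderiv ℝ A y u v w = fderiv ℝ (fun z ↦ A z v w) y u := by
  have h1 : HasFDerivAt (fun z ↦ A z v w)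
      ((ContinuousLinearMap.apply ℝ F w).comp
        ((ContinuousLinearMap.apply ℝ (E →L[ℝ] F) v).comp (fderiv ℝ A y))) y :=
    (ContinuousLinearMap.apply ℝ F w).hasFDerivAt.comp y
      ((ContinuousLinearMap.apply ℝ (E →L[ℝ] F) v).hasFDerivAt.comp y hA.hasFDerivAt)
  rw [h1.fderiv]; rfl

namespace IsMetricOn

variable {G : E → E →L[ℝ] E →L[ℝ] ℝ} {U : Set E} {y : E}

lemma contDiffAt (hG : IsMetricOn G U) (hy : y ∈ U) : ContDiffAt ℝ ∞ G y :=
  (hG.contDiffOn y hy).contDiffAt (hG.isOpen.mem_nhds hy)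

lemma differentiableAt (hG : IsMetricOn G U) (hy : y ∈ U) : DifferentiableAt ℝ G y :=
  (hG.contDiffAt hy).differentiableAt (by simp)

lemma mono (hG : IsMetricOn G U) {V : Set E} (hV : IsOpen V) (h : V ⊆ U) : IsMetricOn G V :=
  ⟨hV, hG.contDiffOn.mono h, fun y hy ↦ hG.symm y (h hy), fun y hy ↦ hG.nondegenerate y (h hy)⟩

lemma fderiv_symm (hG : IsMetricOn G U) (hy : y ∈ U) (u v w : E) :
    fderiv ℝ G y u v w = fderiv ℝ G y u w v := by
  rw [fderiv_apply_apply (hG.differentiableAt hy), fderiv_apply_apply (hG.differentiableAt hy)]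
  congr 1
  apply Filter.EventuallyEq.fderiv_eq
  filter_upwards [hG.isOpen.mem_nhds hy] with z hz using hG.symm z hz v w

lemma eq_of_forall_apply_eq (hG : IsMetricOn G U) (hy : y ∈ U) {u v : E}
    (h : ∀ w, G y u w = G y v w) : u = v := by
  refine sub_eq_zero.1 (hG.nondegenerate y hy _ fun w ↦ ?_)
  simp [h w]

section FiniteDimensional

variable [FiniteDimensional ℝ E]

/-- `ContinuousLinearMap.inverse` is zero at a non-invertible map. Nondegeneracy and equality of
dimensions exclude that case, so `sharp` is a true inverse, and a smooth one. -/
lemma exists_equiv (hG : IsMetricOn G U) (hy : y ∈ U) :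
    ∃ e : E ≃L[ℝ] (E →L[ℝ] ℝ), (e : E →L[ℝ] (E →L[ℝ] ℝ)) = G y := by
  have hinj : Function.Injective (G y : E →ₗ[ℝ] (E →L[ℝ] ℝ)) := by
    rw [← LinearMap.ker_eq_bot, LinearMap.ker_eq_bot']
    intro u hu
    refine hG.nondegenerate y hy u fun v ↦ ?_
    have : G y u = 0 := hu
    simp [this]
  have hfin : Module.finrank ℝ E = Module.finrank ℝ (E →L[ℝ] ℝ) := by
    rw [← (LinearMap.toContinuousLinearMap (𝕜 := ℝ) (E := E) (F' := ℝ)).finrank_eq]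
    exact (Subspace.dual_finrank_eq (K := ℝ) (V := E)).symm
  refine ⟨((G y : E →ₗ[ℝ] (E →L[ℝ] ℝ)).linearEquivOfInjective hinj hfin).toContinuousLinearEquiv,
    ?_⟩
  ext u v
  rfl

lemma apply_sharp (hG : IsMetricOn G U) (hy : y ∈ U) (α : E →L[ℝ] ℝ) :
    G y (sharp G y α) = α := by
  obtain ⟨e, he⟩ := hG.exists_equiv hy
  rw [sharp, ← he, ContinuousLinearMap.inverse_equiv]
  simp

lemma contDiffAt_sharp (hG : IsMetricOn G U) (hy : y ∈ U) : ContDiffAt ℝ ∞ (sharp G) y := by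
  have := FiniteDimensional.complete ℝ E
  obtain ⟨e, he⟩ := hG.exists_equiv hy
  have h := contDiffAt_map_inverse (𝕜 := ℝ) (n := ∞) e
  rw [he] at h
  exact h.comp y (hG.contDiffAt hy)

set_option synthInstance.maxHeartbeats 200000 in
lemma contDiffAt_christoffelBilin (hG : IsMetricOn G U) (hy : y ∈ U) :
    ContDiffAt ℝ ∞ (christoffelBilin G) y := by
  have hD : ContDiffAt ℝ ∞ (fderiv ℝ G) y := (hG.contDiffAt hy).fderiv_right (by simp)
  have hflip : ContDiffAt ℝ ∞ (fun z ↦ (fderiv ℝ G z).flip) y :=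
    (ContinuousLinearMap.flipₗᵢ ℝ E E (E →L[ℝ] ℝ)).contDiff.contDiffAt.comp y hD
  have hK : ContDiffAt ℝ ∞ (koszulBilin G) y :=
    ((hD.add hflip).sub (contDiffAt_const.clm_comp hflip)).const_smul _
  exact ((ContinuousLinearMap.contDiff _).contDiffAt.comp y (hG.contDiffAt_sharp hy)).clm_comp hK

lemma differentiableAt_christoffelBilin (hG : IsMetricOn G U) (hy : y ∈ U) :
    DifferentiableAt ℝ (christoffelBilin G) y :=
  (hG.contDiffAt_christoffelBilin hy).differentiableAt (by simp)

lemma apply_christoffel (hG : IsMetricOn G U) (hy : y ∈ U) (u v w : E) :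
    G y (christoffelBilin G y u v) w =
      (fderiv ℝ G y u v w + fderiv ℝ G y v u w - fderiv ℝ G y w u v) / 2 := by
  rw [christoffelBilin_apply, christoffel, hG.apply_sharp hy, koszul_apply]

lemma christoffel_symm (hG : IsMetricOn G U) (hy : y ∈ U) (u v : E) :
    christoffelBilin G y u v = christoffelBilin G y v u := by
  refine hG.eq_of_forall_apply_eq hy fun w ↦ ?_
  rw [hG.apply_christoffel hy, hG.apply_christoffel hy, hG.fderiv_symm hy w u v]
  ring

/-- The Levi-Civita connection is metric. -/
lemma fderiv_eq (hG : IsMetricOn G U) (hy : y ∈ U) (u v w : E) :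
    fderiv ℝ G y u v w =
      G y (christoffelBilin G y u v) w + G y v (christoffelBilin G y u w) := by
  rw [hG.symm y hy v, hG.apply_christoffel hy, hG.apply_christoffel hy, hG.fderiv_symm hy w u v,
    hG.fderiv_symm hy u w v]
  ring

/-- The Levi-Civita connection is the only torsion-free metric connection. -/
lemma eq_christoffel (hG : IsMetricOn G U) (hy : y ∈ U) {A : E → E → E}
    (hA : ∀ u v, A u v = A v u)
    (h : ∀ u v w, fderiv ℝ G y u v w = G y (A u v) w + G y v (A u w)) (u v : E) :
    A u v = christoffelBilin G y u v := by
  refine hG.eq_of_forall_apply_eq hy fun w ↦ ?_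
  -- Koszul's argument: in the alternating sum of the three derivatives of `G`, symmetry of `A`
  -- cancels everything except `2 G (A u v) w`.
  rw [hG.apply_christoffel hy, h, h, h, hA w u, hA w v, hA v u, hG.symm y hy v,
    hG.symm y hy u (A v w)]
  ring

/-- For constant fields the bracket vanishes and `∇_a b` is the Christoffel symbol itself. Constant
fields suffice because `scalarCurvature` freezes the dual basis at `y`. -/
lemma curvature_eq (hG : IsMetricOn G U) (hy : y ∈ U) (u v w : E) :
    curvature G (fun _ ↦ u) (fun _ ↦ v) (fun _ ↦ w) y = curvatureTensor G y u v w := by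
  have h1 : ∀ a b : E, cov G (fun _ ↦ a) (fun _ ↦ b) = fun z ↦ christoffelBilin G z a b := by
    intro a b
    ext z
    simp [cov, christoffelBilin_apply]
  have h2 : cov G (VectorField.lieBracket ℝ (fun _ : E ↦ u) (fun _ : E ↦ v)) (fun _ ↦ w) y = 0 := by
    simp [cov, VectorField.lieBracket, ← christoffelBilin_apply]
  have hd := hG.differentiableAt_christoffelBilin hy
  rw [curvature, h2, h1, h1, curvatureTensor, fderiv_apply_apply hd, fderiv_apply_apply hd]
  simp only [cov, ← christoffelBilin_apply]
  abel

lemma scalarCurvature_eq (hG : IsMetricOn G U) (hy : y ∈ U) :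
    scalarCurvature G y = ∑ i, ∑ j, G y
      (curvatureTensor G y (Module.finBasis ℝ E i) (Module.finBasis ℝ E j) (sharp G y (coord j)))
      (sharp G y (coord i)) := by
  simp only [scalarCurvature, hG.curvature_eq hy]

lemma contDiffAt_scalarCurvature (hG : IsMetricOn G U) (hy : y ∈ U) :
    ContDiffAt ℝ ∞ (scalarCurvature G) y := by
  have h0 : scalarCurvature G =ᶠ[nhds y] fun z ↦ ∑ i, ∑ j, G z
      (curvatureTensor G z (Module.finBasis ℝ E i) (Module.finBasis ℝ E j) (sharp G z (coord j)))
      (sharp G z (coord i)) := by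
    filter_upwards [hG.isOpen.mem_nhds hy] with z hz using hG.scalarCurvature_eq hz
  refine ContDiffAt.congr_of_eventuallyEq ?_ h0
  have hS : ∀ i, ContDiffAt ℝ ∞ (fun z ↦ sharp G z (coord i)) y := fun i ↦
    (hG.contDiffAt_sharp hy).clm_apply contDiffAt_const
  have hC := hG.contDiffAt_christoffelBilin hy
  have hC' : ContDiffAt ℝ ∞ (fderiv ℝ (christoffelBilin G)) y := hC.fderiv_right (by simp)
  refine ContDiffAt.sum fun i _ ↦ ContDiffAt.sum fun j _ ↦ ?_
  refine ((hG.contDiffAt hy).clm_apply ?_).clm_apply (hS i)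
  simp only [curvatureTensor]
  have c : ∀ v : E, ContDiffAt ℝ ∞ (fun _ : E ↦ v) y := fun v ↦ contDiffAt_const
  exact (((((hC'.clm_apply (c _)).clm_apply (c _)).clm_apply (hS j)).sub
    (((hC'.clm_apply (c _)).clm_apply (c _)).clm_apply (hS j))).add
    ((hC.clm_apply (c _)).clm_apply ((hC.clm_apply (c _)).clm_apply (hS j)))).sub
    ((hC.clm_apply (c _)).clm_apply ((hC.clm_apply (c _)).clm_apply (hS j)))

lemma contDiffAt_laplacian (hG : IsMetricOn G U) (hy : y ∈ U) {f : E → ℂ}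
    (hf : ContDiffAt ℝ ∞ f y) : ContDiffAt ℝ ∞ (laplacian G f) y := by
  have hS : ∀ i, ContDiffAt ℝ ∞ (fun z ↦ sharp G z (coord i)) y := fun i ↦
    (hG.contDiffAt_sharp hy).clm_apply contDiffAt_const
  have hC := hG.contDiffAt_christoffelBilin hy
  have hf1 : ContDiffAt ℝ ∞ (fderiv ℝ f) y := hf.fderiv_right (by simp)
  have hf2 : ContDiffAt ℝ ∞ (fderiv ℝ (fderiv ℝ f)) y := hf1.fderiv_right (by simp)
  have c : ∀ v : E, ContDiffAt ℝ ∞ (fun _ : E ↦ v) y := fun v ↦ contDiffAt_const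
  refine ContDiffAt.sum fun i _ ↦ ?_
  exact ((hf2.clm_apply (c _)).clm_apply (hS i)).sub
    (hf1.clm_apply ((hC.clm_apply (c _)).clm_apply (hS i)))

end FiniteDimensional

end IsMetricOn

end LocalMetric

/-! ### Naturality under isometries. -/

namespace LocalMetric

variable {E : Type*} [NormedAddCommGroup E] [NormedSpace ℝ E]

section Trace

variable [FiniteDimensional ℝ E] {F : Type*} [AddCommGroup F] [Module ℝ F]

lemma sum_coord_smul (u : E) :
    ∑ i, (coord i u : ℝ) • Module.finBasis ℝ E i = u :=
  (Module.finBasis ℝ E).sum_repr u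

lemma sum_apply_smul_coord (α : E →L[ℝ] ℝ) :
    ∑ i, α (Module.finBasis ℝ E i) • (coord i : E →L[ℝ] ℝ) = α := by
  ext u
  conv_rhs => rw [← sum_coord_smul u]
  simp [mul_comm]

/-- The trace `∑ i, C(b_i, b_i^*)` does not depend on the basis `b`. -/
lemma sum_bilin_equiv (C : E →ₗ[ℝ] (E →L[ℝ] ℝ) →ₗ[ℝ] F) (e : E ≃L[ℝ] E) :
    ∑ i, C (e (Module.finBasis ℝ E i)) ((coord i).comp (e.symm : E →L[ℝ] E)) =
      ∑ i, C (Module.finBasis ℝ E i) (coord i) := by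
  have h1 : ∀ i, C (e (Module.finBasis ℝ E i)) ((coord i).comp (e.symm : E →L[ℝ] E)) =
      ∑ k, C (Module.finBasis ℝ E k)
        (coord k (e (Module.finBasis ℝ E i)) • (coord i).comp (e.symm : E →L[ℝ] E)) := by
    intro i
    conv_lhs => rw [← sum_coord_smul (e (Module.finBasis ℝ E i))]
    simp
  -- With the sums exchanged, the matrix of `e` is absorbed by the covector slot, where it cancels
  -- `e.symm`.
  rw [Finset.sum_congr rfl fun i _ ↦ h1 i, Finset.sum_comm]
  refine Finset.sum_congr rfl fun k _ ↦ ?_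
  rw [← map_sum]
  congr 1
  have h2 := sum_apply_smul_coord ((coord k).comp (e : E →L[ℝ] E))
  ext u
  have h3 := congrArg (fun β : E →L[ℝ] ℝ ↦ β (e.symm u)) h2
  simpa using h3

end Trace

/-- `φ` maps `U` to `V`, and `φ^* G' = G` on `U`. -/
structure IsIsometryOn (G : E → E →L[ℝ] E →L[ℝ] ℝ) (U : Set E) (G' : E → E →L[ℝ] E →L[ℝ] ℝ)
    (V : Set E) (φ : E → E) : Prop where
  source : IsMetricOn G U
  target : IsMetricOn G' V
  contDiffOn : ContDiffOn ℝ ∞ φ U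
  mapsTo : Set.MapsTo φ U V
  apply_eq : ∀ y ∈ U, ∀ u v, G y u v = G' (φ y) (fderiv ℝ φ y u) (fderiv ℝ φ y v)

lemma curvatureTensor_add_left (G : E → E →L[ℝ] E →L[ℝ] ℝ) (y u u' v w : E) :
    curvatureTensor G y (u + u') v w = curvatureTensor G y u v w + curvatureTensor G y u' v w := by
  simp only [curvatureTensor, map_add, add_apply]; abel

lemma curvatureTensor_add_middle (G : E → E →L[ℝ] E →L[ℝ] ℝ) (y u v v' w : E) :
    curvatureTensor G y u (v + v') w = curvatureTensor G y u v w + curvatureTensor G y u v' w := by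
  simp only [curvatureTensor, map_add, add_apply]; abel

lemma curvatureTensor_add_right (G : E → E →L[ℝ] E →L[ℝ] ℝ) (y u v w w' : E) :
    curvatureTensor G y u v (w + w') = curvatureTensor G y u v w + curvatureTensor G y u v w' := by
  simp only [curvatureTensor, map_add]; abel

lemma curvatureTensor_smul_left (G : E → E →L[ℝ] E →L[ℝ] ℝ) (y u v w : E) (c : ℝ) :
    curvatureTensor G y (c • u) v w = c • curvatureTensor G y u v w := by
  simp only [curvatureTensor, map_smul, smul_apply, smul_sub, smul_add]

lemma curvatureTensor_smul_middle (G : E → E →L[ℝ] E →L[ℝ] ℝ) (y u v w : E) (c : ℝ) :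
    curvatureTensor G y u (c • v) w = c • curvatureTensor G y u v w := by
  simp only [curvatureTensor, map_smul, smul_apply, smul_sub, smul_add]

lemma curvatureTensor_smul_right (G : E → E →L[ℝ] E →L[ℝ] ℝ) (y u v w : E) (c : ℝ) :
    curvatureTensor G y u v (c • w) = c • curvatureTensor G y u v w := by
  simp only [curvatureTensor, map_smul, smul_sub, smul_add]

lemma isSymm_fderiv_fderiv {F : Type*} [NormedAddCommGroup F] [NormedSpace ℝ F] {f : E → F} {y : E}
    (hf : ContDiffAt ℝ ∞ f y) (u v : E) :
    fderiv ℝ (fderiv ℝ f) y u v = fderiv ℝ (fderiv ℝ f) y v u :=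
  (hf.isSymmSndFDerivAt (by simpa using WithTop.coe_le_coe.2 (le_top : (2 : ℕ∞) ≤ ⊤))) u v

lemma hasFDerivAt_fderiv {F : Type*} [NormedAddCommGroup F] [NormedSpace ℝ F] {f : E → F} {y : E}
    (hf : ContDiffAt ℝ ∞ f y) : HasFDerivAt (fderiv ℝ f) (fderiv ℝ (fderiv ℝ f) y) y :=
  ((hf.fderiv_right (m := ∞) (by simp)).differentiableAt (by simp)).hasFDerivAt

namespace IsIsometryOn

variable {G : E → E →L[ℝ] E →L[ℝ] ℝ} {U : Set E} {G' : E → E →L[ℝ] E →L[ℝ] ℝ} {V : Set E}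
  {φ : E → E} {y : E}

lemma contDiffAt (h : IsIsometryOn G U G' V φ) (hy : y ∈ U) : ContDiffAt ℝ ∞ φ y :=
  (h.contDiffOn y hy).contDiffAt (h.source.isOpen.mem_nhds hy)

lemma hasFDerivAt (h : IsIsometryOn G U G' V φ) (hy : y ∈ U) :
    HasFDerivAt φ (fderiv ℝ φ y) y :=
  ((h.contDiffAt hy).differentiableAt (by simp)).hasFDerivAt

/-- The derivative of the identity `φ^* G' = G`. The second derivatives of `φ` become the
inhomogeneous term in the law of the Christoffel symbols. -/
lemma fderiv_metric (h : IsIsometryOn G U G' V φ) (hy : y ∈ U) (u v w : E) :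
    fderiv ℝ G y u v w =
      fderiv ℝ G' (φ y) (fderiv ℝ φ y u) (fderiv ℝ φ y v) (fderiv ℝ φ y w)
      + G' (φ y) (fderiv ℝ (fderiv ℝ φ) y u v) (fderiv ℝ φ y w)
      + G' (φ y) (fderiv ℝ φ y v) (fderiv ℝ (fderiv ℝ φ) y u w) := by
  rw [fderiv_apply_apply (h.source.differentiableAt hy)]
  have h1 : (fun z ↦ G z v w) =ᶠ[nhds y]
      fun z ↦ G' (φ z) (fderiv ℝ φ z v) (fderiv ℝ φ z w) := by
    filter_upwards [h.source.isOpen.mem_nhds hy] with z hz using h.apply_eq z hz v w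
  have hφ := h.hasFDerivAt hy
  have hφ' := hasFDerivAt_fderiv (h.contDiffAt hy)
  have hG' := (h.target.differentiableAt (h.mapsTo hy)).hasFDerivAt
  have h2 := ((hG'.comp y hφ).clm_apply (hφ'.clm_apply (hasFDerivAt_const v y))).clm_apply
    (hφ'.clm_apply (hasFDerivAt_const w y))
  rw [h1.fderiv_eq]
  have h3 := congrArg (fun A : E →L[ℝ] ℝ ↦ A u) h2.fderiv
  refine h3.trans ?_
  simp
  ring

variable [FiniteDimensional ℝ E]

lemma exists_equiv (h : IsIsometryOn G U G' V φ) (hy : y ∈ U) :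
    ∃ e : E ≃L[ℝ] E, ∀ u, e u = fderiv ℝ φ y u := by
  have hinj : Function.Injective (fderiv ℝ φ y : E →ₗ[ℝ] E) := by
    rw [← LinearMap.ker_eq_bot, LinearMap.ker_eq_bot']
    intro u hu
    refine h.source.nondegenerate y hy u fun v ↦ ?_
    have : fderiv ℝ φ y u = 0 := hu
    simp [h.apply_eq y hy, this]
  exact ⟨(LinearEquiv.ofInjectiveEndo _ hinj).toContinuousLinearEquiv, fun u ↦ rfl⟩

/-- The transformation law of the Christoffel symbols. -/
lemma map_christoffel (h : IsIsometryOn G U G' V φ) (hy : y ∈ U) (u v : E) :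
    fderiv ℝ φ y (christoffelBilin G y u v) = fderiv ℝ (fderiv ℝ φ) y u v +
      christoffelBilin G' (φ y) (fderiv ℝ φ y u) (fderiv ℝ φ y v) := by
  obtain ⟨e, he⟩ := h.exists_equiv hy
  have hV := h.mapsTo hy
  -- The connection of `G'` pulled back by `φ` is torsion-free and metric for `G`, so uniqueness
  -- identifies it.
  have h1 := h.source.eq_christoffel hy (A := fun u v ↦ e.symm (fderiv ℝ (fderiv ℝ φ) y u v +
      christoffelBilin G' (φ y) (fderiv ℝ φ y u) (fderiv ℝ φ y v))) ?_ ?_ u v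
  · rw [← h1, ← he, e.apply_symm_apply]
  · intro u v
    rw [isSymm_fderiv_fderiv (h.contDiffAt hy) u v, h.target.christoffel_symm hV]
  · intro u v w
    rw [h.fderiv_metric hy, h.apply_eq y hy, h.apply_eq y hy, ← he (e.symm _), ← he (e.symm _),
      e.apply_symm_apply, e.apply_symm_apply, h.target.fderiv_eq hV]
    simp only [map_add, add_apply]
    ring

/-- The transformation law holds near `y`, so it may be differentiated there. -/
lemma map_fderiv_christoffel (h : IsIsometryOn G U G' V φ) (hy : y ∈ U) (u v w : E) :
    fderiv ℝ (fderiv ℝ φ) y u (christoffelBilin G y v w)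
      + fderiv ℝ φ y (fderiv ℝ (christoffelBilin G) y u v w) =
    fderiv ℝ (fderiv ℝ (fderiv ℝ φ)) y u v w
      + fderiv ℝ (christoffelBilin G') (φ y) (fderiv ℝ φ y u) (fderiv ℝ φ y v) (fderiv ℝ φ y w)
      + christoffelBilin G' (φ y) (fderiv ℝ (fderiv ℝ φ) y u v) (fderiv ℝ φ y w)
      + christoffelBilin G' (φ y) (fderiv ℝ φ y v) (fderiv ℝ (fderiv ℝ φ) y u w) := by
  have hφ := h.hasFDerivAt hy
  have hφ' := hasFDerivAt_fderiv (h.contDiffAt hy)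
  have hφ'' := hasFDerivAt_fderiv ((h.contDiffAt hy).fderiv_right (m := ∞) (by simp))
  have hΓ := (h.source.differentiableAt_christoffelBilin hy).hasFDerivAt
  have hΓ' := (h.target.differentiableAt_christoffelBilin (h.mapsTo hy)).hasFDerivAt
  have cv := hasFDerivAt_const (𝕜 := ℝ) v y
  have cw := hasFDerivAt_const (𝕜 := ℝ) w y
  have h1 : (fun z ↦ fderiv ℝ φ z (christoffelBilin G z v w)) =ᶠ[nhds y]
      fun z ↦ fderiv ℝ (fderiv ℝ φ) z v w +
        christoffelBilin G' (φ z) (fderiv ℝ φ z v) (fderiv ℝ φ z w) := by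
    filter_upwards [h.source.isOpen.mem_nhds hy] with z hz using h.map_christoffel hz v w
  have hl := hφ'.clm_apply ((hΓ.clm_apply cv).clm_apply cw)
  have hr := ((hφ''.clm_apply cv).clm_apply cw).add
    (((hΓ'.comp y hφ).clm_apply (hφ'.clm_apply cv)).clm_apply (hφ'.clm_apply cw))
  have h2 := congrArg (fun A : E →L[ℝ] E ↦ A u) (hl.unique (hr.congr_of_eventuallyEq h1))
  simp only [ContinuousLinearMap.comp_zero, zero_add, add_apply,
    ContinuousLinearMap.comp_apply, ContinuousLinearMap.flip_apply, Function.comp_apply] at h2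
  rw [add_comm, h2]
  abel

/-- Antisymmetrising in `u` and `v` removes the third derivative of `φ`. The remaining second
derivatives cancel against those produced by the terms quadratic in the Christoffel symbols. -/
lemma map_curvatureTensor (h : IsIsometryOn G U G' V φ) (hy : y ∈ U) (u v w : E) :
    fderiv ℝ φ y (curvatureTensor G y u v w) =
      curvatureTensor G' (φ y) (fderiv ℝ φ y u) (fderiv ℝ φ y v) (fderiv ℝ φ y w) := by
  have h1 := eq_sub_of_add_eq' (h.map_fderiv_christoffel hy u v w)
  have h2 := eq_sub_of_add_eq' (h.map_fderiv_christoffel hy v u w)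
  have h3 := isSymm_fderiv_fderiv ((h.contDiffAt hy).fderiv_right (m := ∞) (by simp)) u v
  rw [curvatureTensor, map_sub, map_add, map_sub, h1, h2, h3,
    isSymm_fderiv_fderiv (h.contDiffAt hy) u v]
  simp only [h.map_christoffel hy, curvatureTensor, map_add]
  abel

/-- The chain rule adds `df` of the second derivative of `φ`, which is exactly what
`map_christoffel` takes away. -/
lemma hessianBilin_comp {F : Type*} [NormedAddCommGroup F] [NormedSpace ℝ F]
    (h : IsIsometryOn G U G' V φ) (hy : y ∈ U) {f : E → F}
    (hf : ContDiffAt ℝ ∞ f (φ y)) (u v : E) :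
    hessianBilin G (f ∘ φ) y u v =
      hessianBilin G' f (φ y) (fderiv ℝ φ y u) (fderiv ℝ φ y v) := by
  have hφ := h.hasFDerivAt hy
  have hφ' := hasFDerivAt_fderiv (h.contDiffAt hy)
  have hf' := hasFDerivAt_fderiv hf
  have h0 : ∀ᶠ z in nhds y, ContDiffAt ℝ 1 f (φ z) :=
    hφ.continuousAt.eventually ((hf.of_le (by simp : (1 : WithTop ℕ∞) ≤ ∞)).eventually (by simp))
  have h1 : fderiv ℝ (f ∘ φ) =ᶠ[nhds y] fun z ↦ (fderiv ℝ f (φ z)).comp (fderiv ℝ φ z) := by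
    filter_upwards [h.source.isOpen.mem_nhds hy, h0] with z hz hz'
    exact fderiv_comp z (hz'.differentiableAt (by simp)) (h.hasFDerivAt hz).differentiableAt
  have h2 := ((hf'.comp y hφ).clm_comp hφ').congr_of_eventuallyEq h1
  rw [hessianBilin_apply, hessianBilin_apply, h2.fderiv, h1.eq_of_nhds]
  simp [h.map_christoffel hy]

lemma map_sharp (h : IsIsometryOn G U G' V φ) (hy : y ∈ U) {e : E ≃L[ℝ] E}
    (he : ∀ u, e u = fderiv ℝ φ y u) (α : E →L[ℝ] ℝ) :
    e (sharp G y α) = sharp G' (φ y) (α.comp (e.symm : E →L[ℝ] E)) := by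
  refine h.target.eq_of_forall_apply_eq (h.mapsTo hy) fun w ↦ ?_
  rw [h.target.apply_sharp (h.mapsTo hy)]
  have h1 := h.apply_eq y hy (sharp G y α) (e.symm w)
  rw [← he, ← he, e.apply_symm_apply, h.source.apply_sharp hy] at h1
  simp [← h1]

lemma laplacian_comp (h : IsIsometryOn G U G' V φ) (hy : y ∈ U) {f : E → ℂ}
    (hf : ContDiffAt ℝ ∞ f (φ y)) :
    laplacian G (f ∘ φ) y = laplacian G' f (φ y) := by
  obtain ⟨e, he⟩ := h.exists_equiv hy
  simp only [laplacian, hessian_eq, h.hessianBilin_comp hy hf]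
  simp only [← he, h.map_sharp hy he]
  exact sum_bilin_equiv (LinearMap.mk₂ ℝ
    (fun u α ↦ hessianBilin G' f (φ y) u (sharp G' (φ y) α))
    (by simp) (by simp) (by simp) (by simp)) e

lemma scalarCurvature_eq (h : IsIsometryOn G U G' V φ) (hy : y ∈ U) :
    scalarCurvature G y = scalarCurvature G' (φ y) := by
  obtain ⟨e, he⟩ := h.exists_equiv hy
  rw [h.source.scalarCurvature_eq hy, h.target.scalarCurvature_eq (h.mapsTo hy)]
  simp only [h.apply_eq y hy, h.map_curvatureTensor hy]
  simp only [← he, h.map_sharp hy he]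
  -- The double trace is changed one index at a time: `j` with `i` fixed, then `i` after exchanging
  -- the sums.
  have h1 : ∀ i, ∑ j, G' (φ y) (curvatureTensor G' (φ y) (e (Module.finBasis ℝ E i))
        (e (Module.finBasis ℝ E j)) (sharp G' (φ y) ((coord j).comp (e.symm : E →L[ℝ] E))))
        (sharp G' (φ y) ((coord i).comp (e.symm : E →L[ℝ] E))) =
      ∑ j, G' (φ y) (curvatureTensor G' (φ y) (e (Module.finBasis ℝ E i))
        (Module.finBasis ℝ E j) (sharp G' (φ y) (coord j)))
        (sharp G' (φ y) ((coord i).comp (e.symm : E →L[ℝ] E))) := fun i ↦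
    sum_bilin_equiv (LinearMap.mk₂ ℝ
      (fun v α ↦ G' (φ y) (curvatureTensor G' (φ y) (e (Module.finBasis ℝ E i)) v
        (sharp G' (φ y) α)) (sharp G' (φ y) ((coord i).comp (e.symm : E →L[ℝ] E))))
      (by simp [curvatureTensor_add_middle]) (by simp [curvatureTensor_smul_middle])
      (by simp [curvatureTensor_add_right]) (by simp [curvatureTensor_smul_right])) e
  rw [Finset.sum_congr rfl fun i _ ↦ h1 i, Finset.sum_comm]
  conv_rhs => rw [Finset.sum_comm]
  refine Finset.sum_congr rfl fun j _ ↦ ?_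
  exact sum_bilin_equiv (LinearMap.mk₂ ℝ
      (fun u α ↦ G' (φ y) (curvatureTensor G' (φ y) u (Module.finBasis ℝ E j)
        (sharp G' (φ y) (coord j))) (sharp G' (φ y) α))
      (by simp [curvatureTensor_add_left]) (by simp [curvatureTensor_smul_left])
      (by simp) (by simp)) e

end IsIsometryOn

end LocalMetric

/-! ### Conformal change of the metric. -/

namespace LocalMetric

variable {E : Type*} [NormedAddCommGroup E] [NormedSpace ℝ E]

/-- The conformal change `e ^ (2 σ) G` of the metric `G`. -/
noncomputable def conformal (σ : E → ℝ) (G : E → E →L[ℝ] E →L[ℝ] ℝ) (y : E) :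
    E →L[ℝ] E →L[ℝ] ℝ :=
  Real.exp (2 * σ y) • G y

lemma hessianBilin_exp_mul (G : E → E →L[ℝ] E →L[ℝ] ℝ) {τ f : E → ℂ} {y : E}
    (hτ : ContDiffAt ℝ ∞ τ y) (hf : ContDiffAt ℝ ∞ f y) (u v : E) :
    hessianBilin G (fun z ↦ Complex.exp (τ z) * f z) y u v = Complex.exp (τ y) *
      (hessianBilin G f y u v + fderiv ℝ τ y v * fderiv ℝ f y u + fderiv ℝ τ y u * fderiv ℝ f y v +
        (hessianBilin G τ y u v + fderiv ℝ τ y u * fderiv ℝ τ y v) * f y) := by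
  have hd : ∀ {F : E → ℂ}, ContDiffAt ℝ ∞ F y → ∀ᶠ z in nhds y, HasFDerivAt F (fderiv ℝ F z) z := by
    intro F hF
    filter_upwards [(hF.of_le (by simp : (1 : WithTop ℕ∞) ≤ ∞)).eventually (by simp)] with z hz
      using (hz.differentiableAt (by simp)).hasFDerivAt
  have h1 : ∀ w, (fun z ↦ fderiv ℝ (fun z ↦ Complex.exp (τ z) * f z) z w) =ᶠ[nhds y]
      fun z ↦ Complex.exp (τ z) * (fderiv ℝ τ z w * f z + fderiv ℝ f z w) := by
    intro w
    filter_upwards [hd hτ, hd hf] with z h1 h2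
    refine (congrArg (fun A : E →L[ℝ] ℂ ↦ A w) (h1.cexp.mul h2).fderiv).trans ?_
    simp
    ring
  have hs : ContDiffAt ℝ ∞ (fun z ↦ Complex.exp (τ z) * f z) y := hτ.cexp.mul hf
  have e1 := congrArg (fun A : E →L[ℝ] ℂ ↦ A u)
    ((hasFDerivAt_fderiv hs).clm_apply (hasFDerivAt_const v y)).fderiv
  have h2 := hasFDerivAt_fderiv hτ |>.clm_apply (hasFDerivAt_const v y)
  have h3 := hasFDerivAt_fderiv hf |>.clm_apply (hasFDerivAt_const v y)
  have h4 := (hd hτ).self_of_nhds.cexp.mul ((h2.mul (hd hf).self_of_nhds).add h3)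
  have e2 := congrArg (fun A : E →L[ℝ] ℂ ↦ A u) h4.fderiv
  have e3 := congrArg (fun A : E →L[ℝ] ℂ ↦ A u) (h1 v).fderiv_eq
  have e4 := (h1 (christoffelBilin G y u v)).eq_of_nhds
  simp only [ContinuousLinearMap.comp_zero, zero_add, ContinuousLinearMap.flip_apply] at e1
  rw [hessianBilin_apply, e4, ← e1, e3]
  refine (congrArg (· - _) e2).trans ?_
  simp [hessianBilin_apply]
  ring

lemma contDiffAt_mul_ofReal {σ : E → ℝ} {y : E} (hσ : ContDiffAt ℝ ∞ σ y) (a : ℂ) :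
    ContDiffAt ℝ ∞ (fun z ↦ a * (σ z : ℂ)) y :=
  contDiffAt_const.mul (Complex.ofRealCLM.contDiff.contDiffAt.comp y hσ)

lemma fderiv_mul_ofReal {σ : E → ℝ} {y : E} (hσ : DifferentiableAt ℝ σ y) (a : ℂ) :
    fderiv ℝ (fun z ↦ a * (σ z : ℂ)) y = (a • Complex.ofRealCLM).comp (fderiv ℝ σ y) :=
  ((a • Complex.ofRealCLM).hasFDerivAt.comp y hσ.hasFDerivAt).fderiv

lemma hessianBilin_mul_ofReal (G : E → E →L[ℝ] E →L[ℝ] ℝ) {σ : E → ℝ} {y : E}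
    (hσ : ContDiffAt ℝ ∞ σ y) (a : ℂ) (u v : E) :
    hessianBilin G (fun z ↦ a * (σ z : ℂ)) y u v = a * (hessianBilin G σ y u v : ℝ) := by
  have h1 : fderiv ℝ (fun z ↦ a * (σ z : ℂ)) =ᶠ[nhds y]
      fun z ↦ (a • Complex.ofRealCLM).comp (fderiv ℝ σ z) := by
    filter_upwards [(hσ.of_le (by simp : (1 : WithTop ℕ∞) ≤ ∞)).eventually (by simp)] with z hz
      using fderiv_mul_ofReal (hz.differentiableAt (by simp)) a
  have h2 := ((hasFDerivAt_const (a • Complex.ofRealCLM) y).clm_comp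
    (hasFDerivAt_fderiv hσ)).congr_of_eventuallyEq h1
  rw [hessianBilin_apply, h1.eq_of_nhds, h2.fderiv, hessianBilin_apply]
  simp [mul_sub]

namespace IsMetricOn

variable {G : E → E →L[ℝ] E →L[ℝ] ℝ} {U : Set E} {y : E} {σ : E → ℝ}

lemma conformal (hG : IsMetricOn G U) (hσ : ContDiffOn ℝ ∞ σ U) :
    IsMetricOn (conformal σ G) U where
  isOpen := hG.isOpen
  contDiffOn := (contDiffOn_const.mul hσ).exp.smul hG.contDiffOn
  symm y hy u v := by simp [LocalMetric.conformal, hG.symm y hy u v]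
  nondegenerate y hy u hu := hG.nondegenerate y hy u fun v ↦ by
    simpa [LocalMetric.conformal] using hu v

lemma fderiv_conformal (hG : IsMetricOn G U) (hσ : ContDiffOn ℝ ∞ σ U) (hy : y ∈ U) (u v w : E) :
    fderiv ℝ (LocalMetric.conformal σ G) y u v w =
      Real.exp (2 * σ y) * (2 * fderiv ℝ σ y u * G y v w + fderiv ℝ G y u v w) := by
  have h1 := ((hσ y hy).contDiffAt (hG.isOpen.mem_nhds hy)).differentiableAt (by simp)
  have h2 := ((h1.hasFDerivAt.const_mul 2).exp).smul (hG.differentiableAt hy).hasFDerivAt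
  have h3 := congrArg (fun A : E →L[ℝ] E →L[ℝ] E →L[ℝ] ℝ ↦ A u v w) h2.fderiv
  refine h3.trans ?_
  simp
  ring

variable [FiniteDimensional ℝ E]

lemma apply_gradient (hG : IsMetricOn G U) (hy : y ∈ U) (α : E →L[ℝ] ℝ) (u : E) :
    G y u (sharp G y α) = α u := by
  rw [hG.symm y hy, hG.apply_sharp hy]

/-- By uniqueness of the Levi-Civita connection, it is enough that the right side is symmetric and
metric for `e ^ (2 σ) G`. -/
lemma christoffel_conformal (hG : IsMetricOn G U) (hσ : ContDiffOn ℝ ∞ σ U) (hy : y ∈ U)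
    (u v : E) :
    christoffelBilin (LocalMetric.conformal σ G) y u v = christoffelBilin G y u v +
      fderiv ℝ σ y u • v + fderiv ℝ σ y v • u - G y u v • sharp G y (fderiv ℝ σ y) := by
  refine ((hG.conformal hσ).eq_christoffel hy (A := fun u v ↦ christoffelBilin G y u v +
    fderiv ℝ σ y u • v + fderiv ℝ σ y v • u - G y u v • sharp G y (fderiv ℝ σ y)) ?_ ?_ u v).symm
  · intro u v
    rw [hG.christoffel_symm hy u v, hG.symm y hy u v]
    abel
  · intro u v w
    rw [hG.fderiv_conformal hσ hy, hG.fderiv_eq hy]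
    simp only [LocalMetric.conformal, smul_apply, map_add, map_sub, map_smul, add_apply,
      sub_apply, smul_eq_mul, hG.apply_sharp hy, hG.apply_gradient hy]
    rw [hG.symm y hy v u]
    ring

lemma sharp_conformal (hG : IsMetricOn G U) (hσ : ContDiffOn ℝ ∞ σ U) (hy : y ∈ U)
    (α : E →L[ℝ] ℝ) :
    sharp (LocalMetric.conformal σ G) y α = Real.exp (-(2 * σ y)) • sharp G y α := by
  refine (hG.conformal hσ).eq_of_forall_apply_eq hy fun w ↦ ?_
  rw [(hG.conformal hσ).apply_sharp hy]
  simp [LocalMetric.conformal, hG.apply_sharp hy, ← mul_assoc, ← Real.exp_add]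

lemma differentiableAt_gradient (hG : IsMetricOn G U) (hσ : ContDiffOn ℝ ∞ σ U) (hy : y ∈ U) :
    DifferentiableAt ℝ (fun z ↦ sharp G z (fderiv ℝ σ z)) y :=
  ((hG.contDiffAt_sharp hy).clm_apply (((hσ y hy).contDiffAt
    (hG.isOpen.mem_nhds hy)).fderiv_right (m := ∞) (by simp))).differentiableAt (by simp)

/-- The Hessian is the covariant derivative of the gradient. -/
lemma apply_cov_gradient (hG : IsMetricOn G U) (hσ : ContDiffOn ℝ ∞ σ U) (hy : y ∈ U) (u v : E) :
    G y (fderiv ℝ (fun z ↦ sharp G z (fderiv ℝ σ z)) y u +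
      christoffelBilin G y u (sharp G y (fderiv ℝ σ y))) v = hessianBilin G σ y u v := by
  have hσy := (hσ y hy).contDiffAt (hG.isOpen.mem_nhds hy)
  have h1 : (fun z ↦ G z (sharp G z (fderiv ℝ σ z)) v) =ᶠ[nhds y] fun z ↦ fderiv ℝ σ z v := by
    filter_upwards [hG.isOpen.mem_nhds hy] with z hz
    rw [hG.apply_sharp hz]
  have h2 := ((hG.differentiableAt hy).hasFDerivAt.clm_apply
    (hG.differentiableAt_gradient hσ hy).hasFDerivAt).clm_apply (hasFDerivAt_const v y)
  have h3 := (hasFDerivAt_fderiv hσy).clm_apply (hasFDerivAt_const v y)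
  have h4 := congrArg (fun A : E →L[ℝ] ℝ ↦ A u) (h2.unique (h3.congr_of_eventuallyEq h1))
  simp only [ContinuousLinearMap.comp_zero, zero_add, add_apply,
    ContinuousLinearMap.comp_apply, ContinuousLinearMap.flip_apply] at h4
  rw [hG.fderiv_eq hy, hG.apply_sharp hy] at h4
  rw [hessianBilin_apply, ← h4]
  simp only [map_add, add_apply]
  ring

lemma fderiv_christoffel_conformal (hG : IsMetricOn G U) (hσ : ContDiffOn ℝ ∞ σ U) (hy : y ∈ U)
    (u v w : E) :
    fderiv ℝ (christoffelBilin (LocalMetric.conformal σ G)) y u v w =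
      fderiv ℝ (christoffelBilin G) y u v w + fderiv ℝ (fderiv ℝ σ) y u v • w
      + fderiv ℝ (fderiv ℝ σ) y u w • v
      - fderiv ℝ G y u v w • sharp G y (fderiv ℝ σ y)
      - G y v w • fderiv ℝ (fun z ↦ sharp G z (fderiv ℝ σ z)) y u := by
  have hσy := hasFDerivAt_fderiv ((hσ y hy).contDiffAt (hG.isOpen.mem_nhds hy))
  have h1 : (fun z ↦ christoffelBilin (LocalMetric.conformal σ G) z v w) =ᶠ[nhds y]
      fun z ↦ christoffelBilin G z v w + fderiv ℝ σ z v • w + fderiv ℝ σ z w • v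
        - G z v w • sharp G z (fderiv ℝ σ z) := by
    filter_upwards [hG.isOpen.mem_nhds hy] with z hz using hG.christoffel_conformal hσ hz v w
  have cv := hasFDerivAt_const (𝕜 := ℝ) v y
  have cw := hasFDerivAt_const (𝕜 := ℝ) w y
  have h2 := (((((hG.differentiableAt_christoffelBilin hy).hasFDerivAt.clm_apply cv).clm_apply
    cw).add ((hσy.clm_apply cv).smul cw)).add ((hσy.clm_apply cw).smul cv)).sub
    ((((hG.differentiableAt hy).hasFDerivAt.clm_apply cv).clm_apply cw).smul
      (hG.differentiableAt_gradient hσ hy).hasFDerivAt)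
  rw [fderiv_apply_apply ((hG.conformal hσ).differentiableAt_christoffelBilin hy)]
  have h3 := congrArg (fun A : E →L[ℝ] E ↦ A u) (h2.congr_of_eventuallyEq h1).fderiv
  refine h3.trans ?_
  simp
  abel

/-- The derivative of the gradient and its Christoffel term are kept together as `∇_u grad σ`, so
that `apply_cov_gradient` turns them into a Hessian when the trace is taken. -/
lemma curvatureTensor_conformal (hG : IsMetricOn G U) (hσ : ContDiffOn ℝ ∞ σ U) (hy : y ∈ U)
    (u v w : E) :
    curvatureTensor (LocalMetric.conformal σ G) y u v w = curvatureTensor G y u v w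
      + (hessianBilin G σ y u w - fderiv ℝ σ y u * fderiv ℝ σ y w) • v
      - (hessianBilin G σ y v w - fderiv ℝ σ y v * fderiv ℝ σ y w) • u
      - G y v w • (fderiv ℝ (fun z ↦ sharp G z (fderiv ℝ σ z)) y u +
        christoffelBilin G y u (sharp G y (fderiv ℝ σ y)))
      + G y u w • (fderiv ℝ (fun z ↦ sharp G z (fderiv ℝ σ z)) y v +
        christoffelBilin G y v (sharp G y (fderiv ℝ σ y)))
      + (G y v w * fderiv ℝ σ y u - G y u w * fderiv ℝ σ y v) • sharp G y (fderiv ℝ σ y)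
      - fderiv ℝ σ y (sharp G y (fderiv ℝ σ y)) • (G y v w • u - G y u w • v) := by
  have hσy := (hσ y hy).contDiffAt (hG.isOpen.mem_nhds hy)
  simp only [curvatureTensor, hG.fderiv_christoffel_conformal hσ hy, hG.christoffel_conformal hσ hy,
    map_add, map_sub, map_smul, hG.fderiv_eq hy, hG.apply_gradient hy, hessianBilin_apply,
    smul_eq_mul]
  rw [hG.christoffel_symm hy v u, hG.symm y hy v u, isSymm_fderiv_fderiv hσy v u]
  module

lemma sum_apply_smul_sharp (y : E) (α : E →L[ℝ] ℝ) :
    ∑ i, α (Module.finBasis ℝ E i) • sharp G y (coord i) = sharp G y α := by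
  conv_rhs => rw [← sum_apply_smul_coord α]
  simp

lemma sum_apply_sharp_smul (hG : IsMetricOn G U) (hy : y ∈ U) (α : E →L[ℝ] ℝ) :
    ∑ i, α (sharp G y (coord i)) • Module.finBasis ℝ E i = sharp G y α := by
  conv_rhs => rw [← sum_coord_smul (sharp G y α)]
  refine Finset.sum_congr rfl fun i _ ↦ ?_
  rw [← hG.apply_gradient hy α, hG.apply_sharp hy]

lemma sum_mul_apply_sharp (y : E) (α β : E →L[ℝ] ℝ) :
    ∑ i, α (Module.finBasis ℝ E i) * β (sharp G y (coord i)) = β (sharp G y α) := by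
  rw [← sum_apply_smul_sharp y α]
  simp

lemma apply_basis_sharp (hG : IsMetricOn G U) (hy : y ∈ U) (i j : Fin (Module.finrank ℝ E)) :
    G y (Module.finBasis ℝ E i) (sharp G y (coord j)) = if i = j then 1 else 0 := by
  rw [hG.apply_gradient hy]
  simp [coord, Finsupp.single_apply]

lemma scalarCurvature_conformal (hG : IsMetricOn G U) (hσ : ContDiffOn ℝ ∞ σ U) (hy : y ∈ U) :
    scalarCurvature (LocalMetric.conformal σ G) y = Real.exp (-(2 * σ y)) * (scalarCurvature G y
      - 2 * (Module.finrank ℝ E - 1) *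
        ∑ i, hessianBilin G σ y (Module.finBasis ℝ E i) (sharp G y (coord i))
      - (Module.finrank ℝ E - 1) * (Module.finrank ℝ E - 2) *
        fderiv ℝ σ y (sharp G y (fderiv ℝ σ y))) := by
  rw [(hG.conformal hσ).scalarCurvature_eq hy, hG.scalarCurvature_eq hy]
  obtain ⟨b, hb⟩ : ∃ b, b = Module.finBasis ℝ E := ⟨_, rfl⟩
  obtain ⟨h, hh⟩ : ∃ h : Fin (Module.finrank ℝ E) → ℝ,
    ∀ i, h i = hessianBilin G σ y (b i) (sharp G y (coord i)) := ⟨_, fun _ ↦ rfl⟩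
  obtain ⟨p, hp⟩ : ∃ p : Fin (Module.finrank ℝ E) → ℝ,
    ∀ i, p i = fderiv ℝ σ y (b i) * fderiv ℝ σ y (sharp G y (coord i)) := ⟨_, fun _ ↦ rfl⟩
  have hq : ∑ i, p i = fderiv ℝ σ y (sharp G y (fderiv ℝ σ y)) := by
    simp only [hp, hb, sum_mul_apply_sharp]
  -- Two dual vectors contribute `e ^ (-4 σ)` and the metric `e ^ (2 σ)`. Summing over `i` and `j`,
  -- the traces of `h` and `p` get a factor `n` off the Kronecker term and `1` on it, whence `2 - 2
  -- n` for `H` and `-2 + n + 2 n - n ^ 2` for `Q`.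
  have key : ∀ i j, LocalMetric.conformal σ G y
      (curvatureTensor (LocalMetric.conformal σ G) y (b i) (b j)
        (sharp (LocalMetric.conformal σ G) y (coord j)))
      (sharp (LocalMetric.conformal σ G) y (coord i)) = Real.exp (-(2 * σ y)) *
      (G y (curvatureTensor G y (b i) (b j) (sharp G y (coord j))) (sharp G y (coord i)) +
        ((if i = j then 2 * h i - 2 * p i + fderiv ℝ σ y (sharp G y (fderiv ℝ σ y)) else 0)
          - h i - h j + p i + p j - fderiv ℝ σ y (sharp G y (fderiv ℝ σ y)))) := by
    intro i j
    rw [hG.sharp_conformal hσ hy, hG.sharp_conformal hσ hy, curvatureTensor_smul_right]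
    simp only [LocalMetric.conformal, map_smul, smul_apply, smul_eq_mul]
    congr 1
    rw [← mul_assoc, ← Real.exp_add, neg_add_cancel, Real.exp_zero, one_mul,
      hG.curvatureTensor_conformal hσ hy, hh, hh, hp, hp]
    simp only [map_add (G y), map_sub (G y), map_smul, add_apply, sub_apply, smul_apply,
      smul_eq_mul, hG.apply_sharp hy]
    subst hb
    simp only [hG.apply_basis_sharp hy, ← add_apply, ← map_add (G y), hG.apply_cov_gradient hσ hy]
    by_cases hij : i = j
    · subst hij
      simp
      ring
    · simp [hij, Ne.symm hij]
      ring
  rw [← hb]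
  simp only [key, ← hh, ← Finset.mul_sum, Finset.sum_add_distrib, Finset.sum_sub_distrib,
    Finset.sum_ite_eq, Finset.mem_univ, if_true, Finset.sum_const, Finset.card_univ,
    Fintype.card_fin, nsmul_eq_mul, hq]
  ring

/-- Tracing the change of the Christoffel symbols gives the gradient twice with one sign and `n`
times with the other, hence `n - 2`. -/
lemma laplacian_conformal (hG : IsMetricOn G U) (hσ : ContDiffOn ℝ ∞ σ U) (hy : y ∈ U)
    (f : E → ℂ) :
    laplacian (LocalMetric.conformal σ G) f y = Real.exp (-(2 * σ y)) *
      (laplacian G f y +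
        (Module.finrank ℝ E - 2) * fderiv ℝ f y (sharp G y (fderiv ℝ σ y))) := by
  have h1 : ∀ i, hessian (LocalMetric.conformal σ G) f y (Module.finBasis ℝ E i)
      (sharp (LocalMetric.conformal σ G) y (coord i)) = Real.exp (-(2 * σ y)) *
      (hessian G f y (Module.finBasis ℝ E i) (sharp G y (coord i))
        - fderiv ℝ f y (fderiv ℝ σ y (Module.finBasis ℝ E i) • sharp G y (coord i))
        - fderiv ℝ f y (fderiv ℝ σ y (sharp G y (coord i)) • Module.finBasis ℝ E i)
        + fderiv ℝ f y (sharp G y (fderiv ℝ σ y))) := by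
    intro i
    rw [hG.sharp_conformal hσ hy, hessian_eq, hessian_eq, map_smul, hessianBilin_apply,
      hG.christoffel_conformal hσ hy, hG.apply_basis_sharp hy, if_pos rfl, one_smul,
      hessianBilin_apply]
    simp only [map_add, map_sub, Complex.real_smul]
    ring
  simp only [laplacian, h1, ← Finset.mul_sum, Finset.sum_add_distrib, Finset.sum_sub_distrib,
    Finset.sum_const, Finset.card_univ, Fintype.card_fin, nsmul_eq_mul]
  simp only [← map_sum, sum_apply_smul_sharp, hG.sum_apply_sharp_smul hy]
  ring

lemma laplacian_exp_mul (hG : IsMetricOn G U) (hσ : ContDiffOn ℝ ∞ σ U) (hy : y ∈ U)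
    {f : E → ℂ} (hf : ContDiffAt ℝ ∞ f y) (a : ℂ) :
    laplacian G (fun z ↦ Complex.exp (a * σ z) * f z) y = Complex.exp (a * σ y) *
      (laplacian G f y + 2 * a * fderiv ℝ f y (sharp G y (fderiv ℝ σ y)) +
        (a * (∑ i, hessianBilin G σ y (Module.finBasis ℝ E i) (sharp G y (coord i)) : ℝ) +
          a ^ 2 * (fderiv ℝ σ y (sharp G y (fderiv ℝ σ y)) : ℝ)) * f y) := by
  have hσy := (hσ y hy).contDiffAt (hG.isOpen.mem_nhds hy)
  have h1 : ∀ i, hessian G (fun z ↦ Complex.exp (a * σ z) * f z) y (Module.finBasis ℝ E i)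
      (sharp G y (coord i)) = Complex.exp (a * σ y) *
      (hessian G f y (Module.finBasis ℝ E i) (sharp G y (coord i))
        + a * fderiv ℝ f y (fderiv ℝ σ y (Module.finBasis ℝ E i) • sharp G y (coord i))
        + a * fderiv ℝ f y (fderiv ℝ σ y (sharp G y (coord i)) • Module.finBasis ℝ E i)
        + a * f y * ((hessianBilin G σ y (Module.finBasis ℝ E i) (sharp G y (coord i)) : ℝ) : ℂ)
        + a ^ 2 * f y * ((fderiv ℝ σ y (Module.finBasis ℝ E i) *
            fderiv ℝ σ y (sharp G y (coord i)) : ℝ) : ℂ)) := by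
    intro i
    rw [hessian_eq, hessian_eq, hessianBilin_exp_mul G (contDiffAt_mul_ofReal hσy a) hf,
      hessianBilin_mul_ofReal G hσy, fderiv_mul_ofReal (hσy.differentiableAt (by simp))]
    simp
    ring
  simp only [laplacian, h1, ← Finset.mul_sum, Finset.sum_add_distrib,
    ← map_sum, sum_apply_smul_sharp, hG.sum_apply_sharp_smul hy, ← Complex.ofReal_sum,
    sum_mul_apply_sharp y]
  ring

end IsMetricOn

variable [FiniteDimensional ℝ E]

/-- The Yamabe operator of a metric on an open subset of `E`. -/
noncomputable def yamabe (G : E → E →L[ℝ] E →L[ℝ] ℝ) (f : E → ℂ) (y : E) : ℂ :=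
  laplacian G f y -
    ((Module.finrank ℝ E : ℂ) - 2) / (4 * ((Module.finrank ℝ E : ℂ) - 1)) *
      (scalarCurvature G y : ℂ) * f y

/-- Conformal covariance of the Yamabe operator. -/
lemma IsMetricOn.yamabe_exp_mul {G : E → E →L[ℝ] E →L[ℝ] ℝ} {U : Set E} {y : E} {σ : E → ℝ}
    (hn : 2 ≤ Module.finrank ℝ E) (hG : IsMetricOn G U) (hσ : ContDiffOn ℝ ∞ σ U) (hy : y ∈ U)
    {f : E → ℂ} (hf : ContDiffAt ℝ ∞ f y) :
    yamabe G (fun z ↦ Complex.exp (((Module.finrank ℝ E : ℂ) - 2) / 2 * σ z) * f z) y =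
      Complex.exp (((Module.finrank ℝ E : ℂ) + 2) / 2 * σ y) *
        yamabe (LocalMetric.conformal σ G) f y := by
  have hn1 : ((Module.finrank ℝ E : ℂ) - 1) ≠ 0 := by
    rw [sub_ne_zero]
    exact_mod_cast (by omega : Module.finrank ℝ E ≠ 1)
  have he : Complex.exp (((Module.finrank ℝ E : ℂ) + 2) / 2 * σ y) =
      Complex.exp (((Module.finrank ℝ E : ℂ) - 2) / 2 * σ y) * Complex.exp (2 * σ y) := by
    rw [← Complex.exp_add]; congr 1; ring
  have he' : Complex.exp (2 * σ y) * Complex.exp (-(2 * σ y)) = 1 := by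
    rw [← Complex.exp_add, add_neg_cancel, Complex.exp_zero]
  -- With `a = (n - 2) / 2` and `c = (n - 2) / (4 (n - 1))`, one has `2 a = n - 2`, `2 (n - 1) c =
  -- a` and `(n - 1) (n - 2) c = a ^ 2`.
  simp only [yamabe, hG.laplacian_exp_mul hσ hy hf, hG.laplacian_conformal hσ hy,
    hG.scalarCurvature_conformal hσ hy, he]
  push_cast
  generalize Complex.exp (2 * σ y) = p at *
  generalize Complex.exp (-(2 * σ y)) = r at *
  generalize Complex.exp (((Module.finrank ℝ E : ℂ) - 2) / 2 * σ y) = t at *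
  generalize (Module.finrank ℝ E : ℂ) = n at *
  field_simp
  rw [mul_assoc _ p r, he']
  ring

/-- Naturality and conformal covariance of the Yamabe operator. -/
lemma IsIsometryOn.yamabe_comp {G : E → E →L[ℝ] E →L[ℝ] ℝ} {U : Set E}
    {G' : E → E →L[ℝ] E →L[ℝ] ℝ} {V : Set E} {φ : E → E} {y : E}
    (h : IsIsometryOn G U G' V φ) (hy : y ∈ U) {f : E → ℂ} (hf : ContDiffAt ℝ ∞ f (φ y)) :
    yamabe G (f ∘ φ) y = yamabe G' f (φ y) := by
  rw [yamabe, yamabe, h.laplacian_comp hy hf, h.scalarCurvature_eq hy, Function.comp_apply]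

end LocalMetric

/-! ### Locality, linearity and regularity of the local Yamabe operator. -/

namespace LocalMetric

variable {E : Type*} [NormedAddCommGroup E] [NormedSpace ℝ E] [FiniteDimensional ℝ E]

lemma yamabe_congr (G : E → E →L[ℝ] E →L[ℝ] ℝ) {f₁ f₂ : E → ℂ} {y : E}
    (h : f₁ =ᶠ[nhds y] f₂) : yamabe G f₁ y = yamabe G f₂ y := by
  simp only [yamabe, laplacian, hessian, h.fderiv.fderiv_eq, h.fderiv_eq, h.eq_of_nhds]

lemma yamabe_add (G : E → E →L[ℝ] E →L[ℝ] ℝ) {f₁ f₂ : E → ℂ} {y : E}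
    (h₁ : ContDiffAt ℝ ∞ f₁ y) (h₂ : ContDiffAt ℝ ∞ f₂ y) :
    yamabe G (f₁ + f₂) y = yamabe G f₁ y + yamabe G f₂ y := by
  have e₁ := (h₁.of_le (by simp : (1 : WithTop ℕ∞) ≤ ∞)).eventually (by simp)
  have e₂ := (h₂.of_le (by simp : (1 : WithTop ℕ∞) ≤ ∞)).eventually (by simp)
  have h : fderiv ℝ (f₁ + f₂) =ᶠ[nhds y] fderiv ℝ f₁ + fderiv ℝ f₂ := by
    filter_upwards [e₁, e₂] with z hz₁ hz₂
    exact fderiv_add (hz₁.differentiableAt (by simp)) (hz₂.differentiableAt (by simp))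
  have h' := h.fderiv_eq.trans (fderiv_add (hasFDerivAt_fderiv h₁).differentiableAt
    (hasFDerivAt_fderiv h₂).differentiableAt)
  simp only [yamabe, laplacian, hessian, h', h.eq_of_nhds, Pi.add_apply, add_apply,
    Finset.sum_add_distrib, Finset.sum_sub_distrib]
  ring

lemma yamabe_smul (G : E → E →L[ℝ] E →L[ℝ] ℝ) (c : ℂ) {f : E → ℂ} {y : E}
    (hf : ContDiffAt ℝ ∞ f y) : yamabe G (c • f) y = c * yamabe G f y := by
  have e := (hf.of_le (by simp : (1 : WithTop ℕ∞) ≤ ∞)).eventually (by simp)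
  have h : fderiv ℝ (c • f) =ᶠ[nhds y] c • fderiv ℝ f := by
    filter_upwards [e] with z hz
    exact fderiv_const_smul (hz.differentiableAt (by simp)) c
  have h' := h.fderiv_eq.trans (fderiv_const_smul (hasFDerivAt_fderiv hf).differentiableAt c)
  simp only [yamabe, laplacian, hessian, h', h.eq_of_nhds, Pi.smul_apply, smul_apply, smul_eq_mul,
    ← mul_sub, ← Finset.mul_sum]
  ring

lemma IsMetricOn.contDiffAt_yamabe {G : E → E →L[ℝ] E →L[ℝ] ℝ} {U : Set E} {y : E}
    (hG : IsMetricOn G U) (hy : y ∈ U) {f : E → ℂ} (hf : ContDiffAt ℝ ∞ f y) :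
    ContDiffAt ℝ ∞ (yamabe G f) y :=
  (hG.contDiffAt_laplacian hy hf).sub ((contDiffAt_const.mul
    (Complex.ofRealCLM.contDiff.contDiffAt.comp y (hG.contDiffAt_scalarCurvature hy))).mul hf)

end LocalMetric

/-! ### Metrics and conformal maps read in charts. -/

open LocalMetric IsManifold

section

variable {E : Type*} [NormedAddCommGroup E] [NormedSpace ℝ E]
  {M : Type*} [TopologicalSpace M] [ChartedSpace E M] [IsManifold 𝓘(ℝ, E) ∞ M]
  {g : PseudoRiemannianMetric E M} {e e' : OpenPartialHomeomorph M E}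

lemma contDiffOn_comp_symm {F : Type*} [NormedAddCommGroup F] [NormedSpace ℝ F] {f : M → F}
    (hf : ContMDiff 𝓘(ℝ, E) 𝓘(ℝ, F) ∞ f) (he : e ∈ maximalAtlas 𝓘(ℝ, E) ∞ M) :
    ContDiffOn ℝ ∞ (f ∘ e.symm) e.target :=
  (hf.comp_contMDiffOn (contMDiffOn_symm_of_mem_maximalAtlas he)).contDiffOn

lemma contDiffAt_comp_symm {F : Type*} [NormedAddCommGroup F] [NormedSpace ℝ F] {f : M → F}
    (hf : ContMDiff 𝓘(ℝ, E) 𝓘(ℝ, F) ∞ f) (he : e ∈ maximalAtlas 𝓘(ℝ, E) ∞ M) {y : E}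
    (hy : y ∈ e.target) : ContDiffAt ℝ ∞ (f ∘ e.symm) y :=
  (contDiffOn_comp_symm hf he y hy).contDiffAt (e.open_target.mem_nhds hy)

lemma contMDiffAt_of_contDiffAt_comp_symm {F : Type*} [NormedAddCommGroup F] [NormedSpace ℝ F]
    {f : M → F} {f' : E → F} (he : e ∈ maximalAtlas 𝓘(ℝ, E) ∞ M) {x : M} (hx : x ∈ e.source)
    (hf' : ContDiffAt ℝ ∞ f' (e x)) (h : ∀ᶠ z in nhds x, f z = f' (e z)) :
    ContMDiffAt 𝓘(ℝ, E) 𝓘(ℝ, F) ∞ f x :=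
  (hf'.contMDiffAt.comp x ((contMDiffOn_of_mem_maximalAtlas he x hx).contMDiffAt
    (e.open_source.mem_nhds hx))).congr_of_eventuallyEq h

namespace PseudoRiemannianMetric

lemma val_congr (g : PseudoRiemannianMetric E M) {p q : M} (h : p = q) (u v : E) :
    (g.val p : E →L[ℝ] E →L[ℝ] ℝ) u v = (g.val q : E →L[ℝ] E →L[ℝ] ℝ) u v := by
  subst h; rfl

lemma inChart_apply (g : PseudoRiemannianMetric E M) (e : OpenPartialHomeomorph M E) (y u v : E) :
    g.inChart e y u v = g.val (e.symm y) (mfderiv 𝓘(ℝ, E) 𝓘(ℝ, E) e.symm y u)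
      (mfderiv 𝓘(ℝ, E) 𝓘(ℝ, E) e.symm y v) := rfl

lemma _root_.mdifferentiable_of_mem_maximalAtlas (he : e ∈ maximalAtlas 𝓘(ℝ, E) ∞ M) :
    e.MDifferentiable 𝓘(ℝ, E) 𝓘(ℝ, E) :=
  ⟨(contMDiffOn_of_mem_maximalAtlas he).mdifferentiableOn (by simp),
    (contMDiffOn_symm_of_mem_maximalAtlas he).mdifferentiableOn (by simp)⟩

/-- A constant vector pushed forward by `e.symm` is a smooth vector field along `e.symm`, and the
metric, a smooth section, is evaluated on two of these. -/
lemma contDiffOn_inChart_apply (g : PseudoRiemannianMetric E M)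
    (he : e ∈ maximalAtlas 𝓘(ℝ, E) ∞ M) (u v : E) :
    ContDiffOn ℝ ∞ (fun y ↦ g.inChart e y u v) e.target := by
  have hs := contMDiffOn_symm_of_mem_maximalAtlas he
  have hsec : ∀ w : E, ContMDiffOn 𝓘(ℝ, E) 𝓘(ℝ, E).tangent ∞
      (fun y ↦ Bundle.TotalSpace.mk' E (E := TangentSpace 𝓘(ℝ, E) (M := M)) (e.symm y)
        (mfderiv 𝓘(ℝ, E) 𝓘(ℝ, E) e.symm y w)) e.target := by
    intro w
    have h1 : ContMDiffOn 𝓘(ℝ, E) 𝓘(ℝ, E).tangent ∞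
        (fun y : E ↦ (⟨y, w⟩ : TangentBundle 𝓘(ℝ, E) E)) e.target := fun y _ ↦
      (contMDiffAt_vectorSpace_iff_contDiffAt (V := fun _ ↦ w).2 contDiffAt_const).contMDiffWithinAt
    have h2 := (hs.contMDiffOn_tangentMapWithin (m := ∞) (by simp)
      e.open_target.uniqueMDiffOn).comp h1 (fun y hy ↦ hy)
    refine h2.congr fun y hy ↦ ?_
    simp only [Function.comp_apply, tangentMapWithin]
    rw [mfderivWithin_of_isOpen e.open_target hy]
  have h := ContMDiffOn.clm_bundle_apply₂ (F₁ := E) (F₂ := E) (F₃ := ℝ)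
    (E₁ := fun x : M ↦ TangentSpace 𝓘(ℝ, E) x) (E₂ := fun x : M ↦ TangentSpace 𝓘(ℝ, E) x)
    (E₃ := Bundle.Trivial M ℝ) (b := e.symm) (ψ := fun y ↦ g.val (e.symm y))
    (g.contMDiff.comp_contMDiffOn hs) (hsec u) (hsec v)
  rw [← contMDiffOn_iff_contDiffOn]
  intro y hy
  have h' := h y hy
  simp only [Bundle.contMDiffWithinAt_totalSpace] at h'
  exact h'.2

variable [FiniteDimensional ℝ E]

lemma isMetricOn_inChart (g : PseudoRiemannianMetric E M)
    (he : e ∈ maximalAtlas 𝓘(ℝ, E) ∞ M) : IsMetricOn (g.inChart e) e.target where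
  isOpen := e.open_target
  contDiffOn := contDiffOn_clm_apply.2 fun u ↦ contDiffOn_clm_apply.2 fun v ↦
    g.contDiffOn_inChart_apply he u v
  symm y _ u v := g.symm (e.symm y) (mfderiv 𝓘(ℝ, E) 𝓘(ℝ, E) e.symm y u)
    (mfderiv 𝓘(ℝ, E) 𝓘(ℝ, E) e.symm y v)
  nondegenerate y hy u hu := by
    have hb := (mdifferentiable_of_mem_maximalAtlas he).symm.mfderiv_bijective hy
    have hz : mfderiv 𝓘(ℝ, E) 𝓘(ℝ, E) e.symm y u = 0 :=
      g.nondegenerate (e.symm y) (mfderiv 𝓘(ℝ, E) 𝓘(ℝ, E) e.symm y u) fun v ↦ by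
        obtain ⟨w, hw⟩ := hb.2 v
        rw [← hw]
        exact hu w
    exact hb.1 (hz.trans (map_zero (mfderiv 𝓘(ℝ, E) 𝓘(ℝ, E) e.symm y)).symm)

end PseudoRiemannianMetric

open PseudoRiemannianMetric

/-- The map `Φ` read in the charts `e` and `e'` is conformal with factor `Ω`. -/
lemma IsConformalFactor.inChart_apply {Φ : M → M} {Ω : M → ℝ} (h : IsConformalFactor g Φ Ω)
    (hΦ : ContMDiff 𝓘(ℝ, E) 𝓘(ℝ, E) ∞ Φ) (he : e ∈ maximalAtlas 𝓘(ℝ, E) ∞ M)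
    (he' : e' ∈ maximalAtlas 𝓘(ℝ, E) ∞ M) {y : E} (hy : y ∈ e.target)
    (hy' : Φ (e.symm y) ∈ e'.source) (u v : E) :
    Ω (e.symm y) ^ 2 * g.inChart e y u v = g.inChart e' (e' (Φ (e.symm y)))
      (fderiv ℝ (e' ∘ Φ ∘ e.symm) y u) (fderiv ℝ (e' ∘ Φ ∘ e.symm) y v) := by
  have d := mdifferentiable_of_mem_maximalAtlas he
  have d' := mdifferentiable_of_mem_maximalAtlas he'
  have hΦd : MDifferentiableAt 𝓘(ℝ, E) 𝓘(ℝ, E) Φ (e.symm y) :=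
    (hΦ _).mdifferentiableAt (by simp)
  have h1 : MDifferentiableAt 𝓘(ℝ, E) 𝓘(ℝ, E) (Φ ∘ e.symm) y :=
    hΦd.comp y (d.mdifferentiableAt_symm hy)
  have h2 : MDifferentiableAt 𝓘(ℝ, E) 𝓘(ℝ, E) (e' ∘ Φ ∘ e.symm) y :=
    (d'.mdifferentiableAt hy').comp y h1
  -- The two sides agree only near `y`, which suffices to compare the chain rules for both
  -- factorisations.
  have h3 : e'.symm ∘ (e' ∘ Φ ∘ e.symm) =ᶠ[nhds y] Φ ∘ e.symm := by
    filter_upwards [h1.continuousAt.preimage_mem_nhds (e'.open_source.mem_nhds hy')] with z hz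
    exact e'.left_inv hz
  have h4 := h3.mfderiv_eq (I := 𝓘(ℝ, E)) (I' := 𝓘(ℝ, E))
  have h5 : mfderiv 𝓘(ℝ, E) 𝓘(ℝ, E) (e'.symm ∘ (e' ∘ Φ ∘ e.symm)) y = _ :=
    mfderiv_comp y (d'.mdifferentiableAt_symm (e'.map_source hy')) h2
  have h6 := mfderiv_comp y hΦd (d.mdifferentiableAt_symm hy)
  have h7 : ∀ w : E, (mfderiv 𝓘(ℝ, E) 𝓘(ℝ, E) e'.symm (e' (Φ (e.symm y)))
      (fderiv ℝ (e' ∘ Φ ∘ e.symm) y w) : E) =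
      mfderiv 𝓘(ℝ, E) 𝓘(ℝ, E) Φ (e.symm y) (mfderiv 𝓘(ℝ, E) 𝓘(ℝ, E) e.symm y w) := by
    intro w
    rw [← mfderiv_eq_fderiv]
    exact (congrArg (fun A : E →L[ℝ] E ↦ A w) h5).symm.trans
      ((congrArg (fun A : E →L[ℝ] E ↦ A w) h4).trans (congrArg (fun A : E →L[ℝ] E ↦ A w) h6))
  rw [PseudoRiemannianMetric.inChart_apply, PseudoRiemannianMetric.inChart_apply, ← h.2]
  refine (g.val_congr (e'.left_inv hy').symm _ _).trans ?_
  exact (congrArg₂ (fun a b : E ↦ (g.val (e'.symm (e' (Φ (e.symm y)))) : E →L[ℝ] E →L[ℝ] ℝ) a b)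
    (h7 u) (h7 v)).symm

lemma isOpen_inter_preimage_chart {Φ : M → M} (hΦ : Continuous Φ) :
    IsOpen (e.target ∩ (Φ ∘ e.symm) ⁻¹' e'.source) :=
  (hΦ.comp_continuousOn e.continuousOn_symm).isOpen_inter_preimage e.open_target e'.open_source

lemma contDiffOn_chart_comp {Φ : M → M} (hΦ : ContMDiff 𝓘(ℝ, E) 𝓘(ℝ, E) ∞ Φ)
    (he : e ∈ maximalAtlas 𝓘(ℝ, E) ∞ M) (he' : e' ∈ maximalAtlas 𝓘(ℝ, E) ∞ M) :
    ContDiffOn ℝ ∞ (e' ∘ Φ ∘ e.symm) (e.target ∩ (Φ ∘ e.symm) ⁻¹' e'.source) :=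
  ((contMDiffOn_of_mem_maximalAtlas he').comp (t := e'.source)
    ((hΦ.comp_contMDiffOn (contMDiffOn_symm_of_mem_maximalAtlas he)).mono Set.inter_subset_left)
    (fun _ hz ↦ hz.2)).contDiffOn

variable [FiniteDimensional ℝ E]

lemma PseudoRiemannianMetric.exists_val_ne_zero (hn : 0 < Module.finrank ℝ E)
    (g : PseudoRiemannianMetric E M) (x : M) :
    ∃ u v : TangentSpace 𝓘(ℝ, E) x, g.val x u v ≠ 0 := by
  have : Nontrivial E := Module.nontrivial_of_finrank_pos hn
  obtain ⟨u, hu⟩ := exists_ne (0 : E)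
  by_contra! h
  exact hu (g.nondegenerate x u (h u))

/-! ### Uniqueness, composition and smoothness of conformal factors. -/

namespace IsConformalFactor

variable {Φ Ψ : M → M} {Ω Ω' : M → ℝ}

/-- In positive dimension `g` takes a nonzero value at `x`, which determines `Ω x ^ 2`; positivity
then determines `Ω x`. -/
lemma eq_of_finrank_pos (hn : 0 < Module.finrank ℝ E) (h : IsConformalFactor g Φ Ω)
    (h' : IsConformalFactor g Φ Ω') (x : M) : Ω x = Ω' x := by
  obtain ⟨u, v, huv⟩ := g.exists_val_ne_zero hn x
  have h1 := mul_right_cancel₀ huv ((h.2 x u v).symm.trans (h'.2 x u v))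
  exact (sq_eq_sq₀ (h.1 x).le (h'.1 x).le).1 h1

lemma id : IsConformalFactor g (fun x ↦ x) (fun _ ↦ 1) := by
  refine ⟨fun _ ↦ one_pos, fun x u v ↦ ?_⟩
  have h : mfderiv 𝓘(ℝ, E) 𝓘(ℝ, E) (fun x : M ↦ x) x = ContinuousLinearMap.id ℝ _ := mfderiv_id
  rw [h]
  simp

lemma comp (h : IsConformalFactor g Φ Ω) (h' : IsConformalFactor g Ψ Ω')
    (hΦ : MDifferentiable 𝓘(ℝ, E) 𝓘(ℝ, E) Φ) (hΨ : MDifferentiable 𝓘(ℝ, E) 𝓘(ℝ, E) Ψ) :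
    IsConformalFactor g (fun x ↦ Φ (Ψ x)) (fun x ↦ Ω' x * Ω (Ψ x)) := by
  refine ⟨fun x ↦ mul_pos (h'.1 x) (h.1 _), fun x u v ↦ ?_⟩
  have h1 : mfderiv 𝓘(ℝ, E) 𝓘(ℝ, E) (fun x ↦ Φ (Ψ x)) x = _ :=
    mfderiv_comp x (hΦ (Ψ x)) (hΨ x)
  rw [h1]
  exact (h.2 (Ψ x) _ _).trans ((congrArg (Ω (Ψ x) ^ 2 * ·) (h'.2 x u v)).trans (by ring))

/-- A conformal factor of a smooth map is smooth. -/
lemma contMDiff (hn : 0 < Module.finrank ℝ E) (h : IsConformalFactor g Φ Ω)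
    (hΦ : ContMDiff 𝓘(ℝ, E) 𝓘(ℝ, E) ∞ Φ) : ContMDiff 𝓘(ℝ, E) 𝓘(ℝ, ℝ) ∞ Ω := by
  intro x
  have he := chart_mem_maximalAtlas (I := 𝓘(ℝ, E)) (n := ∞) x
  have he' := chart_mem_maximalAtlas (I := 𝓘(ℝ, E)) (n := ∞) (Φ x)
  generalize hee : chartAt E x = e at he
  generalize hee' : chartAt E (Φ x) = e' at he'
  have hx : x ∈ e.source := hee ▸ mem_chart_source E x
  have hx' : Φ x ∈ e'.source := hee' ▸ mem_chart_source E (Φ x)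
  have hG := g.isMetricOn_inChart he
  have hG' := g.isMetricOn_inChart he'
  have hy : e x ∈ e.target := e.map_source hx
  have hyU : e x ∈ e.target ∩ (Φ ∘ e.symm) ⁻¹' e'.source := ⟨hy, by simpa [hx] using hx'⟩
  have hU := (isOpen_inter_preimage_chart (e := e) (e' := e') hΦ.continuous).mem_nhds hyU
  -- For fixed `u` and `v`, near `e x` the square of `Ω` is a quotient of smooth functions, with
  -- nonzero denominator; its root is smooth because `Ω` is positive.
  obtain ⟨u, v, huv⟩ : ∃ u v, g.inChart e (e x) u v ≠ 0 := by
    have : Nontrivial E := Module.nontrivial_of_finrank_pos hn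
    obtain ⟨u, hu⟩ := exists_ne (0 : E)
    by_contra! h
    exact hu (hG.nondegenerate _ hy u (h u))
  have hφ := ((contDiffOn_chart_comp hΦ he he') _ hyU).contDiffAt hU
  have hφ' := hφ.fderiv_right (m := ∞) (by simp)
  have hden : ContDiffAt ℝ ∞ (fun y ↦ g.inChart e y u v) (e x) :=
    ((hG.contDiffAt hy).clm_apply contDiffAt_const).clm_apply contDiffAt_const
  have hnum : ContDiffAt ℝ ∞ (fun y ↦ g.inChart e' ((e' ∘ Φ ∘ e.symm) y)
      (fderiv ℝ (e' ∘ Φ ∘ e.symm) y u) (fderiv ℝ (e' ∘ Φ ∘ e.symm) y v)) (e x) :=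
    ((ContDiffAt.comp (e x) (hG'.contDiffAt (e'.map_source hyU.2)) hφ).clm_apply
      (hφ'.clm_apply contDiffAt_const)).clm_apply (hφ'.clm_apply contDiffAt_const)
  have hev : ∀ y, y ∈ e.target ∩ (Φ ∘ e.symm) ⁻¹' e'.source → g.inChart e y u v ≠ 0 →
      Ω (e.symm y) ^ 2 = g.inChart e' ((e' ∘ Φ ∘ e.symm) y)
        (fderiv ℝ (e' ∘ Φ ∘ e.symm) y u) (fderiv ℝ (e' ∘ Φ ∘ e.symm) y v) /
          g.inChart e y u v := fun y hyU hne ↦ by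
    rw [eq_div_iff hne]
    exact h.inChart_apply hΦ he he' hyU.1 hyU.2 u v
  refine contMDiffAt_of_contDiffAt_comp_symm he hx
    ((hnum.div hden huv).sqrt ?_) ?_
  · exact ne_of_eq_of_ne (hev _ hyU huv).symm (pow_pos (h.1 _) 2).ne'
  · have hc : ContinuousAt e x := e.continuousAt hx
    filter_upwards [hc.preimage_mem_nhds hU, e.open_source.mem_nhds hx,
      hc.eventually (hden.continuousAt.eventually_ne huv)] with z hz hzs hne
    refine Eq.trans ?_ (congrArg Real.sqrt (hev _ hz hne))
    rw [Real.sqrt_sq (h.1 _).le, e.left_inv hzs]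

/-- A conformal map is an isometry for the rescaled metric on its source; this joins naturality to
the conformal change. -/
lemma isIsometryOn_inChart (h : IsConformalFactor g Φ Ω)
    (hΦ : ContMDiff 𝓘(ℝ, E) 𝓘(ℝ, E) ∞ Φ) (hΩ : ContMDiff 𝓘(ℝ, E) 𝓘(ℝ, ℝ) ∞ Ω)
    (he : e ∈ maximalAtlas 𝓘(ℝ, E) ∞ M) (he' : e' ∈ maximalAtlas 𝓘(ℝ, E) ∞ M) :
    IsIsometryOn (conformal (fun y ↦ Real.log (Ω (e.symm y))) (g.inChart e))
      (e.target ∩ (Φ ∘ e.symm) ⁻¹' e'.source) (g.inChart e') e'.target (e' ∘ Φ ∘ e.symm) where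
  source := ((g.isMetricOn_inChart he).mono (isOpen_inter_preimage_chart hΦ.continuous)
    Set.inter_subset_left).conformal (((contDiffOn_comp_symm hΩ he).mono
      Set.inter_subset_left).log fun y _ ↦ (h.1 _).ne')
  target := g.isMetricOn_inChart he'
  contDiffOn := contDiffOn_chart_comp hΦ he he'
  mapsTo _ hy := e'.map_source hy.2
  apply_eq y hy u v := by
    refine Eq.trans ?_ (h.inChart_apply hΦ he he' hy.1 hy.2 u v)
    simp only [conformal, smul_apply, smul_eq_mul]
    rw [two_mul, Real.exp_add, Real.exp_log (h.1 _), sq]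

/-- Conformal covariance of the Yamabe operator read in charts. -/
lemma yamabe_inChart (hn : 2 ≤ Module.finrank ℝ E) (h : IsConformalFactor g Φ Ω)
    (hΦ : ContMDiff 𝓘(ℝ, E) 𝓘(ℝ, E) ∞ Φ) (hΩ : ContMDiff 𝓘(ℝ, E) 𝓘(ℝ, ℝ) ∞ Ω)
    (he : e ∈ maximalAtlas 𝓘(ℝ, E) ∞ M) (he' : e' ∈ maximalAtlas 𝓘(ℝ, E) ∞ M) {x : M}
    (hx : x ∈ e.source) (hx' : Φ x ∈ e'.source) {f : M → ℂ}
    (hf : ContMDiff 𝓘(ℝ, E) 𝓘(ℝ, ℂ) ∞ f) :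
    LocalMetric.yamabe (g.inChart e)
      ((fun z ↦ (Ω z : ℂ) ^ (((Module.finrank ℝ E : ℂ) - 2) / 2) * f (Φ z)) ∘ e.symm) (e x) =
    (Ω x : ℂ) ^ (((Module.finrank ℝ E : ℂ) + 2) / 2) *
      LocalMetric.yamabe (g.inChart e') (f ∘ e'.symm) (e' (Φ x)) := by
  have hpow : ∀ (z : M) (a : ℂ), (Ω z : ℂ) ^ a = Complex.exp (a * (Real.log (Ω z) : ℝ)) := by
    intro z a
    rw [Complex.cpow_def_of_ne_zero (by exact_mod_cast (h.1 z).ne'), Complex.ofReal_log (h.1 z).le,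
      mul_comm]
  have hyU : e x ∈ e.target ∩ (Φ ∘ e.symm) ⁻¹' e'.source :=
    ⟨e.map_source hx, by simpa [hx] using hx'⟩
  have hopen := isOpen_inter_preimage_chart (e := e) (e' := e') hΦ.continuous
  have hI := h.isIsometryOn_inChart hΦ hΩ he he'
  have hfy : ContDiffAt ℝ ∞ (f ∘ e'.symm) ((e' ∘ Φ ∘ e.symm) (e x)) :=
    contDiffAt_comp_symm hf he' (hI.mapsTo hyU)
  have h1 : ((fun z ↦ (Ω z : ℂ) ^ (((Module.finrank ℝ E : ℂ) - 2) / 2) * f (Φ z)) ∘ e.symm)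
      =ᶠ[nhds (e x)] fun y ↦ Complex.exp (((Module.finrank ℝ E : ℂ) - 2) / 2 *
        (Real.log (Ω (e.symm y)) : ℝ)) * ((f ∘ e'.symm) ∘ (e' ∘ Φ ∘ e.symm)) y := by
    filter_upwards [hopen.mem_nhds hyU] with y hy
    simp only [Function.comp_apply, hpow]
    rw [e'.left_inv (show Φ (e.symm y) ∈ e'.source from hy.2)]
  rw [yamabe_congr _ h1, ((g.isMetricOn_inChart he).mono hopen
    Set.inter_subset_left).yamabe_exp_mul (σ := fun y ↦ Real.log (Ω (e.symm y))) hn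
    (((contDiffOn_comp_symm hΩ he).mono Set.inter_subset_left).log fun y _ ↦ (h.1 _).ne') hyU
    (hfy.comp _ (hI.contDiffAt hyU)), hI.yamabe_comp hyU hfy, hpow]
  simp only [Function.comp_apply, e.left_inv hx]

end IsConformalFactor

/-! ### The Yamabe operator on `M`. -/

namespace PseudoRiemannianMetric

lemma yamabe_eq (g : PseudoRiemannianMetric E M) (f : M → ℂ) (x : M) :
    g.yamabe f x = LocalMetric.yamabe (g.inChart (chartAt E x)) (f ∘ (chartAt E x).symm)
      (chartAt E x x) := by
  simp [yamabe, LocalMetric.yamabe, laplacian, scalarCurvature]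

/-- The Yamabe operator can be computed in any chart. -/
lemma yamabe_eq_inChart (hn : 2 ≤ Module.finrank ℝ E) (g : PseudoRiemannianMetric E M) {f : M → ℂ}
    (hf : ContMDiff 𝓘(ℝ, E) 𝓘(ℝ, ℂ) ∞ f) (he : e ∈ maximalAtlas 𝓘(ℝ, E) ∞ M) {x : M}
    (hx : x ∈ e.source) :
    g.yamabe f x = LocalMetric.yamabe (g.inChart e) (f ∘ e.symm) (e x) := by
  -- A change of charts is the identity of `M`, conformal with factor `1`, read in two different
  -- charts.
  have h := (IsConformalFactor.id (g := g)).yamabe_inChart hn contMDiff_id contMDiff_const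
    he (chart_mem_maximalAtlas x) hx (mem_chart_source E x) hf
  simp only [Complex.ofReal_one, Complex.one_cpow, one_mul] at h
  rw [yamabe_eq, ← h]

/-- The chart in the definition of `yamabe` varies with the point. Chart independence allows one
fixed chart near `x`. -/
lemma contMDiff_yamabe (hn : 2 ≤ Module.finrank ℝ E) (g : PseudoRiemannianMetric E M) {f : M → ℂ}
    (hf : ContMDiff 𝓘(ℝ, E) 𝓘(ℝ, ℂ) ∞ f) : ContMDiff 𝓘(ℝ, E) 𝓘(ℝ, ℂ) ∞ (g.yamabe f) := by
  intro x
  have he := chart_mem_maximalAtlas (I := 𝓘(ℝ, E)) (n := ∞) x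
  have hx := mem_chart_source E x
  have hy := (chartAt E x).map_source hx
  refine contMDiffAt_of_contDiffAt_comp_symm he hx
    ((g.isMetricOn_inChart he).contDiffAt_yamabe hy (contDiffAt_comp_symm hf he hy)) ?_
  filter_upwards [(chartAt E x).open_source.mem_nhds hx] with z hz
    using g.yamabe_eq_inChart hn hf he hz

lemma yamabe_conformal (hn : 2 ≤ Module.finrank ℝ E) {Φ : M → M} {Ω : M → ℝ}
    (h : IsConformalFactor g Φ Ω) (hΦ : ContMDiff 𝓘(ℝ, E) 𝓘(ℝ, E) ∞ Φ) {f : M → ℂ}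
    (hf : ContMDiff 𝓘(ℝ, E) 𝓘(ℝ, ℂ) ∞ f) (x : M) :
    g.yamabe (fun z ↦ (Ω z : ℂ) ^ (((Module.finrank ℝ E : ℂ) - 2) / 2) * f (Φ z)) x =
      (Ω x : ℂ) ^ (((Module.finrank ℝ E : ℂ) + 2) / 2) * g.yamabe f (Φ x) := by
  rw [yamabe_eq, yamabe_eq]
  exact h.yamabe_inChart hn hΦ (h.contMDiff (by omega) hΦ) (chart_mem_maximalAtlas x)
    (chart_mem_maximalAtlas (Φ x)) (mem_chart_source E x) (mem_chart_source E (Φ x)) hf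

lemma yamabe_add (g : PseudoRiemannianMetric E M) {f₁ f₂ : M → ℂ}
    (h₁ : ContMDiff 𝓘(ℝ, E) 𝓘(ℝ, ℂ) ∞ f₁) (h₂ : ContMDiff 𝓘(ℝ, E) 𝓘(ℝ, ℂ) ∞ f₂) (x : M) :
    g.yamabe (f₁ + f₂) x = g.yamabe f₁ x + g.yamabe f₂ x := by
  have hy := (chartAt E x).map_source (mem_chart_source E x)
  rw [yamabe_eq, yamabe_eq, yamabe_eq]
  exact LocalMetric.yamabe_add _ (contDiffAt_comp_symm h₁ (chart_mem_maximalAtlas x) hy)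
    (contDiffAt_comp_symm h₂ (chart_mem_maximalAtlas x) hy)

lemma yamabe_smul (g : PseudoRiemannianMetric E M) (c : ℂ) {f : M → ℂ}
    (hf : ContMDiff 𝓘(ℝ, E) 𝓘(ℝ, ℂ) ∞ f) (x : M) :
    g.yamabe (c • f) x = c * g.yamabe f x := by
  have hy := (chartAt E x).map_source (mem_chart_source E x)
  rw [yamabe_eq, yamabe_eq]
  exact LocalMetric.yamabe_smul _ c (contDiffAt_comp_symm hf (chart_mem_maximalAtlas x) hy)

/-- The Yamabe operator as a linear endomorphism of `C^∞(M)`. -/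
noncomputable def yamabeLinear (hn : 2 ≤ Module.finrank ℝ E) (g : PseudoRiemannianMetric E M) :
    SmoothFunctions E M →ₗ[ℂ] SmoothFunctions E M where
  toFun f := ⟨g.yamabe f.1, g.contMDiff_yamabe hn f.2⟩
  map_add' f₁ f₂ := Subtype.ext (funext (g.yamabe_add f₁.2 f₂.2))
  map_smul' c f := Subtype.ext (funext (g.yamabe_smul c f.2))

end PseudoRiemannianMetric

lemma contMDiff_ofReal_cpow {Ω : M → ℝ} (hpos : ∀ x, 0 < Ω x)
    (hΩ : ContMDiff 𝓘(ℝ, E) 𝓘(ℝ, ℝ) ∞ Ω) (a : ℂ) :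
    ContMDiff 𝓘(ℝ, E) 𝓘(ℝ, ℂ) ∞ (fun x ↦ (Ω x : ℂ) ^ a) := by
  intro x
  have h : ContDiffAt ℝ ∞ (fun t : ℝ ↦ Complex.exp (a * (Real.log t : ℝ))) (Ω x) :=
    (contDiffAt_mul_ofReal (Real.contDiffAt_log.2 (hpos x).ne') a).cexp
  refine (h.contMDiffAt.comp x (hΩ x)).congr_of_eventuallyEq <|
    Filter.Eventually.of_forall fun z ↦ ?_
  simp only [Function.comp_apply]
  rw [Complex.cpow_def_of_ne_zero (by exact_mod_cast (hpos z).ne'), Complex.ofReal_log (hpos z).le,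
    mul_comm]

/-- The operator `f ↦ Ω ^ lam * (f ∘ Φ)` on `C^∞(M)`. -/
noncomputable def weightedPullback {Φ : M → M} (hΦ : ContMDiff 𝓘(ℝ, E) 𝓘(ℝ, E) ∞ Φ) {Ω : M → ℝ}
    (hpos : ∀ x, 0 < Ω x) (hΩ : ContMDiff 𝓘(ℝ, E) 𝓘(ℝ, ℝ) ∞ Ω) (lam : ℂ) :
    SmoothFunctions E M →ₗ[ℂ] SmoothFunctions E M where
  toFun f := ⟨fun x ↦ (Ω x : ℂ) ^ lam * f.1 (Φ x),
    (contDiff_mul (𝕜 := ℝ) (𝔸 := ℂ)).contMDiff.comp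
      ((contMDiff_ofReal_cpow hpos hΩ lam).prodMk_space (ContMDiff.comp f.2 hΦ))⟩
  map_add' _ _ := Subtype.ext (funext fun _ ↦ mul_add _ _ _)
  map_smul' _ _ := Subtype.ext (funext fun _ ↦ mul_left_comm _ _ _)

/-! ### The twisted representations. -/

section Representation

variable {G : Type*} [Group G] [MulAction G M] {Ω : G → M → ℝ}

lemma conformalFactor_one (hn : 0 < Module.finrank ℝ E)
    (hΩ : ∀ h : G, IsConformalFactor g (fun x : M ↦ h • x) (Ω h)) (x : M) : Ω 1 x = 1 := by
  have h := hΩ 1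
  simp only [one_smul] at h
  exact h.eq_of_finrank_pos hn IsConformalFactor.id x

/-- The chain rule shows that the right side is also a conformal factor of `h₁ * h₂`; uniqueness
gives this cocycle identity. -/
lemma conformalFactor_mul (hn : 0 < Module.finrank ℝ E)
    (hsmooth : ∀ h : G, ContMDiff 𝓘(ℝ, E) 𝓘(ℝ, E) ∞ (fun x : M ↦ h • x))
    (hΩ : ∀ h : G, IsConformalFactor g (fun x : M ↦ h • x) (Ω h)) (h₁ h₂ : G) (x : M) :
    Ω (h₁ * h₂) x = Ω h₂ x * Ω h₁ (h₂ • x) := by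
  have h := hΩ (h₁ * h₂)
  simp only [mul_smul] at h
  exact h.eq_of_finrank_pos hn ((hΩ h₁).comp (hΩ h₂) ((hsmooth h₁).mdifferentiable (by simp))
    ((hsmooth h₂).mdifferentiable (by simp))) x

/-- The representation of a conformal group action on `C^∞(M)` twisted by the power `lam` of the
conformal factor. -/
noncomputable def twistedRepresentation (hn : 0 < Module.finrank ℝ E)
    (hsmooth : ∀ h : G, ContMDiff 𝓘(ℝ, E) 𝓘(ℝ, E) ∞ (fun x : M ↦ h • x))
    (hΩ : ∀ h : G, IsConformalFactor g (fun x : M ↦ h • x) (Ω h)) (lam : ℂ) :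
    Representation ℂ G (SmoothFunctions E M) where
  -- Pullback reverses products, so the inverse is needed for a left action.
  toFun h := weightedPullback (hsmooth h⁻¹) (hΩ h⁻¹).1 ((hΩ h⁻¹).contMDiff hn (hsmooth h⁻¹)) lam
  map_one' := by
    ext f x
    simp [weightedPullback, conformalFactor_one hn hΩ]
  map_mul' h₁ h₂ := by
    ext f x
    simp only [weightedPullback, mul_inv_rev, conformalFactor_mul hn hsmooth hΩ, mul_smul,
      Complex.ofReal_mul]
    -- Complex powers are multiplicative here because the bases are nonnegative reals.
    refine (congrArg (· * _) (Complex.mul_cpow_ofReal_nonneg ((hΩ _).1 _).le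
      ((hΩ _).1 _).le lam)).trans (mul_assoc _ _ _)

lemma twistedRepresentation_apply (hn : 0 < Module.finrank ℝ E)
    (hsmooth : ∀ h : G, ContMDiff 𝓘(ℝ, E) 𝓘(ℝ, E) ∞ (fun x : M ↦ h • x))
    (hΩ : ∀ h : G, IsConformalFactor g (fun x : M ↦ h • x) (Ω h)) (lam : ℂ) (h : G)
    (f : SmoothFunctions E M) (x : M) :
    (twistedRepresentation hn hsmooth hΩ lam h f).1 x =
      (Ω h⁻¹ x : ℂ) ^ lam * f.1 (h⁻¹ • x) := rfl

end Representation

end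

/-- `ϖ lam` is the twisted representation of `G` on `C^∞(M)` with parameter `lam`. -/
theorem theorem2p5 {E : Type*} [NormedAddCommGroup E] [NormedSpace ℝ E] [FiniteDimensional ℝ E]
    (hn : 2 ≤ Module.finrank ℝ E)
    {M : Type*} [TopologicalSpace M] [ChartedSpace E M] [IsManifold 𝓘(ℝ, E) ∞ M]
    (g : PseudoRiemannianMetric E M)
    {G : Type*} [Group G] [MulAction G M]
    (hsmooth : ∀ h : G, ContMDiff 𝓘(ℝ, E) 𝓘(ℝ, E) ∞ (fun x : M ↦ h • x))
    (Ω : G → M → ℝ) (hΩ : ∀ h : G, IsConformalFactor g (fun x : M ↦ h • x) (Ω h)) :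
    ∃ (ϖ : ℂ → Representation ℂ G (SmoothFunctions E M))
      (D : Representation.IntertwiningMap
        (ϖ (((Module.finrank ℝ E : ℂ) - 2) / 2)) (ϖ (((Module.finrank ℝ E : ℂ) + 2) / 2)))
      (K : Subrepresentation (ϖ (((Module.finrank ℝ E : ℂ) - 2) / 2))),
      (∀ (lam : ℂ) (h : G) (f : SmoothFunctions E M) (x : M),
        (ϖ lam h⁻¹ f).1 x = (Ω h x : ℂ) ^ lam * f.1 (h • x)) ∧
      (∀ (f : SmoothFunctions E M) (x : M), (D f).1 x = g.yamabe f.1 x) ∧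
      (∀ f : SmoothFunctions E M, f ∈ K ↔ ∀ x : M, g.yamabe f.1 x = 0) := by
  have hn0 : 0 < Module.finrank ℝ E := by omega
  have hD : ∀ (h : G) (f : SmoothFunctions E M),
      g.yamabeLinear hn (twistedRepresentation hn0 hsmooth hΩ _ h f) =
        twistedRepresentation hn0 hsmooth hΩ _ h (g.yamabeLinear hn f) := fun h f ↦
    Subtype.ext (funext (PseudoRiemannianMetric.yamabe_conformal hn (hΩ h⁻¹) (hsmooth h⁻¹) f.2))
  refine ⟨twistedRepresentation hn0 hsmooth hΩ,
    (g.yamabeLinear hn).intertwiningMap_of_isIntertwiningMap _ _ hD,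
    ⟨LinearMap.ker (g.yamabeLinear hn), fun h f hf ↦ ?_⟩, fun lam h f x ↦ ?_, fun f x ↦ rfl,
    fun f ↦ ?_⟩
  · rw [LinearMap.mem_ker] at hf ⊢
    rw [hD, hf, map_zero]
  · rw [twistedRepresentation_apply, inv_inv]
  · exact ⟨fun hf x ↦ congrFun (congrArg Subtype.val hf) x, fun hf ↦ Subtype.ext (funext hf)⟩
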